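/- Let $(a,q)_n=\prod_{k=0}^{n-1}(1-aq^k)$ and, for $m\ge 1$, $(q^m)_\infty=\prod_{k\ge 1}(1-q^{mk})$. Define integers $c_5(n)$, $c_{10}(n)$ $(n\in\mathbb Z)$ as the coefficients of $q^n$ in the $q$-expansions of the hauptmoduln for $\Gamma_0(5)$ and $\Gamma_0(10)$, $$j_5=\frac1q\,\frac{(q)_\infty^6}{(q^5)_\infty^6}=\sum_{n\ge -1}c_5(n)q^n,\qquad j_{10}=\frac1q\,\frac{(q^2)_\infty(q^5)_\infty^5}{(q)_\infty(q^{10})_\infty^5}=\sum_{n\ge -1}c_{10}(n)q^n$$ (with $c_5(n)=c_{10}(n)=0$ for $n<-1$), and let $c_{X_{10}}(n)$, $c_{\chi_{10}}(n)$ be the coefficients of $q^n$ in the 10th order mock theta functions $$X_{10}(q)=\sum_{n\ge0}\frac{(-1)^nq^{n^2}}{(-q,q)_{2n}},\qquad \chi_{10}(q)=\sum_{n\ge0}\frac{(-1)^nq^{(n+1)^2}}{(-q,q)_{2n+1}}.$$ Let $p_{10}(n)$ be the number of partitions of $n$ in which no part is a multiple of $10$. Then $c_5(n)\equiv c_{10}(n)\pmod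 2$ for all $n\ge1$, and for all integers $n\ge0$: 1. $c_5(2n)\equiv c_5(8n+3)\equiv c_5(40n+5+8i)\equiv c_5(40n+7+8j)\equiv 0\pmod 2$ for $i\in\{1,2,3,4\}$ and $j\in\{0,2\}$. 2. $c_5(40n-1)\equiv c_{X_{10}}(n)\pmod 2$. 3. $c_5(40n-9)\equiv c_{\chi_{10}}(n)\pmod 2$. 4. $c_5(8n+1)\equiv c_5(40n+5)\pmod 2$, and $c_5(8n+1)\equiv1\pmod 2$ if and only if $n=\frac{k(k+1)}2$ for some integer $k\ge0$. 5. $c_5(40n+15)\equiv p_{10}(n)\pmod 2$. -/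

import Mathlib

open PowerSeries
open scoped PowerSeries.WithPiTopology

namespace HauptMock

noncomputable section

/-- The finite q-Pochhammer symbol `(a, q)_n = ∏_{k=0}^{n-1} (1 - a q ^ k)` of two integral
power series. -/
def qPoch (a q : ℤ⟦X⟧) (n : ℕ) : ℤ⟦X⟧ := ∏ k ∈ Finset.range n, (1 - a * q ^ k)

/-- The infinite product `(q ^ m)_∞ = (q ^ m, q ^ m)_∞ = ∏_{k ≥ 0} (1 - q ^ m * (q ^ m) ^ k)`,
for `m ≥ 1`, as a power series in the variable `q = X` (it converges coefficientwise, see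
`multipliable_eulerProd`). -/
def eulerProd (m : ℕ) : ℤ⟦X⟧ := ∏' k : ℕ, (1 - (X : ℤ⟦X⟧) ^ m * (X ^ m) ^ k)

/-- The inverse of a power series with constant coefficient `1` (see `mul_inv1`). -/
def inv1 (f : ℤ⟦X⟧) : ℤ⟦X⟧ := PowerSeries.invOfUnit f 1

/-- The q-expansion of the hauptmodul `j_5 = η_1 ^ 6 / η_5 ^ 6` of `Γ_0(5)`, where
`η_k = q ^ (k / 24) (q ^ k)_∞`. The powers of `q` in front have total exponent
`(6 * 1 - 6 * 5) / 24 = -1`. -/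
def j5 : LaurentSeries ℤ :=
  HahnSeries.single (-1 : ℤ) (1 : ℤ) *
    HahnSeries.ofPowerSeries ℤ ℤ (eulerProd 1 ^ 6 * inv1 (eulerProd 5 ^ 6))

/-- The q-expansion of the hauptmodul `j_10 = (η_2 η_5 ^ 5) / (η_1 η_10 ^ 5)` of `Γ_0(10)`. The
powers of `q` in front have total exponent `(2 + 5 * 5 - 1 - 5 * 10) / 24 = -1`. -/
def j10 : LaurentSeries ℤ :=
  HahnSeries.single (-1 : ℤ) (1 : ℤ) *
    HahnSeries.ofPowerSeries ℤ ℤ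
      (eulerProd 2 * eulerProd 5 ^ 5 * inv1 (eulerProd 1 * eulerProd 10 ^ 5))

/-- `c_5(n)`: the coefficient of `q ^ n` in `j_5`. -/
def c5 (n : ℤ) : ℤ := j5.coeff n

/-- `c_10(n)`: the coefficient of `q ^ n` in `j_10`. -/
def c10 (n : ℤ) : ℤ := j10.coeff n

/-- The 10th order mock theta function
`X_10(q) = ∑_{n ≥ 0} (-1) ^ n q ^ (n ^ 2) / (-q, q)_{2 n}`. -/
def mockX10 : ℤ⟦X⟧ :=
  ∑' n : ℕ, (-1 : ℤ⟦X⟧) ^ n * X ^ (n ^ 2) * inv1 (qPoch (-X) X (2 * n))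

/-- The 10th order mock theta function
`χ_10(q) = ∑_{n ≥ 0} (-1) ^ n q ^ ((n + 1) ^ 2) / (-q, q)_{2 n + 1}`. -/
def mockChi10 : ℤ⟦X⟧ :=
  ∑' n : ℕ, (-1 : ℤ⟦X⟧) ^ n * X ^ ((n + 1) ^ 2) * inv1 (qPoch (-X) X (2 * n + 1))

/-- The coefficient of `q ^ n` in `X_10(q)`. -/
def cX10 (n : ℕ) : ℤ := PowerSeries.coeff n mockX10

/-- The coefficient of `q ^ n` in `χ_10(q)`. -/
def cChi10 (n : ℕ) : ℤ := PowerSeries.coeff n mockChi10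

/-- `p_10(n)`: the number of partitions of `n` in which no part is a multiple of `10`. -/
def p10 (n : ℕ) : ℕ :=
  (Finset.univ.filter fun p : n.Partition => ∀ i ∈ p.parts, ¬ 10 ∣ i).card

/-! The infinite products and series above converge, and the inverses are genuine. -/

theorem mul_inv1 {f : ℤ⟦X⟧} (hf : constantCoeff f = 1) : f * inv1 f = 1 :=
  PowerSeries.mul_invOfUnit f 1 (by simpa using hf)

theorem constantCoeff_qPoch (n : ℕ) : constantCoeff (qPoch (-X) X n) = 1 := by
  simp [qPoch, map_prod]

theorem multipliable_eulerProd {m : ℕ} (hm : 1 ≤ m) :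
    Multipliable fun k : ℕ => (1 - (X : ℤ⟦X⟧) ^ m * (X ^ m) ^ k) := by
  have h : ∀ k : ℕ, (1 - (X : ℤ⟦X⟧) ^ m * (X ^ m) ^ k) = 1 + -(X ^ (m * (k + 1))) := by
    intro k; ring
  simp only [h]
  refine PowerSeries.WithPiTopology.multipliable_one_add_of_tendsto_order_atTop_nhds_top ℤ ?_
  simp only [order_neg, order_X_pow]
  refine ENat.tendsto_nhds_top_iff_natCast_lt.mpr fun n => ?_
  filter_upwards [Filter.eventually_ge_atTop n] with k hk
  exact_mod_cast lt_of_lt_of_le (Nat.lt_succ_of_le hk) (Nat.le_mul_of_pos_left _ hm)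

theorem constantCoeff_eulerProd {m : ℕ} (hm : 1 ≤ m) : constantCoeff (eulerProd m) = 1 := by
  rw [eulerProd, (multipliable_eulerProd hm).map_tprod (constantCoeff (R := ℤ))
    (PowerSeries.WithPiTopology.continuous_constantCoeff ℤ)]
  have h0 : m ≠ 0 := by omega
  simp [h0]

theorem summable_of_X_pow_mul (e : ℕ → ℕ) (he : ∀ n, n ≤ e n) (f g : ℕ → ℤ⟦X⟧) :
    Summable fun n : ℕ => f n * X ^ e n * g n := by
  refine PowerSeries.WithPiTopology.summable_of_tendsto_order_atTop_nhds_top ℤ ?_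
  refine ENat.tendsto_nhds_top_iff_natCast_lt.mpr fun n => ?_
  filter_upwards [Filter.eventually_ge_atTop (n + 1)] with k hk
  refine lt_of_lt_of_le (b := ((n + 1 : ℕ) : ℕ∞)) (by exact_mod_cast Nat.lt_succ_self n) ?_
  refine PowerSeries.nat_le_order _ _ fun i hi => ?_
  have hd : (X : ℤ⟦X⟧) ^ e k ∣ f k * X ^ e k * g k := ⟨f k * g k, by ring⟩
  exact PowerSeries.X_pow_dvd_iff.mp hd i (lt_of_lt_of_le hi (hk.trans (he k)))

theorem summable_mockX10 :
    Summable fun n : ℕ => (-1 : ℤ⟦X⟧) ^ n * X ^ (n ^ 2) * inv1 (qPoch (-X) X (2 * n)) :=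
  summable_of_X_pow_mul (fun n => n ^ 2) (fun n => Nat.le_self_pow two_ne_zero n) _ _

theorem summable_mockChi10 :
    Summable fun n : ℕ =>
      (-1 : ℤ⟦X⟧) ^ n * X ^ ((n + 1) ^ 2) * inv1 (qPoch (-X) X (2 * n + 1)) :=
  summable_of_X_pow_mul (fun n => (n + 1) ^ 2)
    (fun n => (Nat.le_succ n).trans (Nat.le_self_pow two_ne_zero (n + 1))) _ _

end

end HauptMock

/-! Write E_m for the reduction of (q^m)_∞ modulo 2 (`eu m`). Squaring in F_2[[q]] replaces q by
q^2, so E_{2m} = E_m^2, and the expansion of q j_5 reduces to C^2 with C = E_1^3/E_5^3 (`cubeQuot`).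
Hence even-indexed coefficients of j_5 vanish modulo 2, and c_5(2k-1) is coefficient k of C.

Everything rests on E_1 E_5 = E_1^6 + q E_5^6 (`eu_one_mul_eu_five`). This is the reduction of
Ramanujan's ψ(q)^2 - qψ(q^5)^2 = f(q,q^4) f(q^2,q^3), itself proved by a bijection coming from
multiplication by 2 + i on Gaussian integers. Divided by E_5^6, the equation says that j_10 and j_5
differ modulo 2 by a constant. Applied repeatedly, it yields the 4-dissection C = (E_1^2/E_5)^4 + q
(E_1^3)^4 + q^3 (E_5^3)^4. The empty class 2 gives c_5(8n+3); the classes of E_1^3 ≡ ψ and of E_5^3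
= E_1^3(q^5) give part 4 and the family 40n+5+8i.

The class of E_1^2/E_5 = E_2/E_5 is then 5-dissected by Euler's pentagonal series for E_2, whose
exponents 3j^2 - j avoid the residues 1 and 3 modulo 5. The remaining classes are E_10/E_1, which
generates p_10, and two sums of theta series over E_1. The latter are the mock theta functions
modulo 2: signs disappear, (-q,q)_n becomes (q,q)_n, and Slater's identities (`tsum_sq_iq_even`,
`tsum_sq_iq_odd`) apply. Those are proved by a Bailey pair argument from Rogers–Schur sums of
Gaussian binomials and the Durfee rectangle identity. -/

namespace HauptMock

open Filter Topology

/-! ### Monomials with integer exponents and X-adic convergence -/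

/-- The monomial `X ^ n`, with an integer exponent that is truncated at `0`. -/
noncomputable def xp (n : ℤ) : ℤ⟦X⟧ := X ^ n.toNat

theorem xp_mul {a b : ℤ} (ha : 0 ≤ a) (hb : 0 ≤ b) : xp a * xp b = xp (a + b) := by
  rw [xp, xp, xp, ← pow_add, Int.toNat_add ha hb]

theorem xp_zero : xp 0 = 1 := by simp [xp]

theorem xp_natCast (n : ℕ) : xp n = X ^ n := by simp [xp]

theorem tendsto_iff_X_pow_dvd {α : Type*} {l : Filter α} {f : α → ℤ⟦X⟧} {g : ℤ⟦X⟧} :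
    Tendsto f l (𝓝 g) ↔ ∀ K : ℕ, ∀ᶠ a in l, X ^ K ∣ f a - g := by
  rw [PowerSeries.WithPiTopology.tendsto_iff_coeff_tendsto]
  simp only [nhds_discrete, tendsto_pure]
  constructor
  · intro h K
    have : ∀ᶠ a in l, ∀ d ∈ Finset.range K, coeff d (f a) = coeff d g :=
      (Finset.eventually_all _).2 fun d _ => h d
    filter_upwards [this] with a ha
    rw [X_pow_dvd_iff]
    intro m hm
    rw [map_sub, ha m (Finset.mem_range.2 hm), sub_self]
  · intro h d
    filter_upwards [h (d + 1)] with a ha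
    have := X_pow_dvd_iff.1 ha d (Nat.lt_succ_self d)
    rwa [map_sub, sub_eq_zero] at this

theorem coeff_xp_mul_of_lt {n : ℤ} {d : ℕ} (h : (d : ℤ) < n) (g : ℤ⟦X⟧) :
    coeff d (xp n * g) = 0 := by
  rw [xp, coeff_X_pow_mul', if_neg]
  omega

section Sums

variable {ι : Type*} {f : ι → ℤ}

theorem finite_le_of_tendsto (hf : Tendsto f cofinite atTop) (n : ℤ) : {i | f i ≤ n}.Finite := by
  have := tendsto_atTop.1 hf (n + 1)
  refine (eventually_cofinite.1 this).subset fun i hi => ?_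
  simp only [Set.mem_ofPred_eq] at *
  omega

theorem coeff_tsum_xp_mul (hf : Tendsto f cofinite atTop) (g : ι → ℤ⟦X⟧) (d : ℕ) :
    HasSum (fun i => coeff d (xp (f i) * g i))
      (∑ i ∈ (finite_le_of_tendsto hf d).toFinset, coeff d (xp (f i) * g i)) := by
  refine hasSum_sum_of_ne_finset_zero fun i hi => coeff_xp_mul_of_lt ?_ _
  simpa using hi

theorem summable_xp_mul (hf : Tendsto f cofinite atTop) (g : ι → ℤ⟦X⟧) :
    Summable fun i => xp (f i) * g i :=
  (PowerSeries.WithPiTopology.summable_iff_summable_coeff _).2 fun d =>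
    (coeff_tsum_xp_mul hf g d).summable

theorem coeff_tsum_xp_mul_eq_sum (hf : Tendsto f cofinite atTop) (g : ι → ℤ⟦X⟧) (d : ℕ) :
    coeff d (∑' i, xp (f i) * g i) =
      ∑ i ∈ (finite_le_of_tendsto hf d).toFinset, coeff d (xp (f i) * g i) :=
  (((PowerSeries.WithPiTopology.hasSum_iff_hasSum_coeff _).1
    (summable_xp_mul hf g).hasSum d).unique (coeff_tsum_xp_mul hf g d))

theorem summable_xp (hf : Tendsto f cofinite atTop) : Summable fun i => xp (f i) := by
  simpa using summable_xp_mul hf fun _ => 1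

/-- Termwise passage to the limit in a sum of power series whose orders tend to infinity. -/
theorem tendsto_tsum_xp_mul {α : Type*} {l : Filter α} (hf : Tendsto f cofinite atTop)
    {g : α → ι → ℤ⟦X⟧} {G : ι → ℤ⟦X⟧} (h : ∀ i, Tendsto (fun a => g a i) l (𝓝 (G i))) :
    Tendsto (fun a => ∑' i, xp (f i) * g a i) l (𝓝 (∑' i, xp (f i) * G i)) := by
  rw [PowerSeries.WithPiTopology.tendsto_iff_coeff_tendsto]
  intro d
  simp only [coeff_tsum_xp_mul_eq_sum hf]
  refine tendsto_finsetSum _ fun i _ => ?_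
  exact (PowerSeries.WithPiTopology.tendsto_iff_coeff_tendsto _ _ _ _).1
    (tendsto_const_nhds.mul (h i)) d

end Sums

theorem tendsto_cofinite_of_abs_le {f : ℤ → ℤ} (h : ∀ j, |j| ≤ f j) :
    Tendsto f cofinite atTop := by
  refine tendsto_atTop.2 fun n => ?_
  refine (Set.finite_Icc (-n) n).subset fun j hj => ?_
  simp only [Set.mem_compl_iff, Set.mem_ofPred_eq, not_le] at hj
  exact abs_le.1 ((h j).trans hj.le)

theorem tendsto_cofinite_of_natCast_le {f : ℕ → ℤ} (h : ∀ j : ℕ, (j : ℤ) ≤ f j) :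
    Tendsto f cofinite atTop := by
  rw [Nat.cofinite_eq_atTop]
  exact tendsto_atTop_mono h tendsto_natCast_atTop_atTop

theorem tendsto_cofinite_add {ι κ : Type*} {f : ι → ℤ} {g : κ → ℤ} (hf : Tendsto f cofinite atTop)
    (hg : Tendsto g cofinite atTop) (hf0 : ∀ i, 0 ≤ f i) (hg0 : ∀ i, 0 ≤ g i) :
    Tendsto (fun p : ι × κ => f p.1 + g p.2) cofinite atTop := by
  refine tendsto_atTop.2 fun n => ?_
  refine ((finite_le_of_tendsto hf n).prod (finite_le_of_tendsto hg n)).subset fun p hp => ?_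
  simp only [Set.mem_compl_iff, Set.mem_ofPred_eq, not_le] at hp
  have h1 := hf0 p.1
  have h2 := hg0 p.2
  exact ⟨by simp only [Set.mem_ofPred_eq]; omega, by simp only [Set.mem_ofPred_eq]; omega⟩

theorem abs_le_quadratic {a b c : ℤ} (h : |b| + 1 ≤ a) (hc : 0 ≤ c) (j : ℤ) :
    |j| ≤ a * j ^ 2 + b * j + c := by
  have h1 : |j| ≤ |j| ^ 2 := by
    rcases eq_or_ne j 0 with rfl | hj
    · simp
    · nlinarith [Int.one_le_abs hj]
  have h2 : -(|b| * |j|) ≤ b * j := by rw [← abs_mul]; exact neg_abs_le _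
  have h3 := abs_nonneg b
  rw [← sq_abs j]
  nlinarith [abs_nonneg j]

/-! ### Gaussian binomial coefficients -/

theorem constantCoeff_qPoch_X {c : ℕ} (hc : 1 ≤ c) (n : ℕ) :
    constantCoeff (qPoch (X ^ c) (X ^ c) n) = 1 := by
  have : c ≠ 0 := by omega
  simp [qPoch, map_prod, this]

theorem tendsto_qPoch {c : ℕ} (hc : 1 ≤ c) :
    Tendsto (qPoch (X ^ c) (X ^ c)) atTop (𝓝 (eulerProd c)) :=
  (multipliable_eulerProd hc).hasProd.tendsto_prod_nat

theorem tendsto_inv1 {α : Type*} {l : Filter α} {f : α → ℤ⟦X⟧} {g : ℤ⟦X⟧}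
    (hf : ∀ a, constantCoeff (f a) = 1) (hg : constantCoeff g = 1) (h : Tendsto f l (𝓝 g)) :
    Tendsto (fun a => inv1 (f a)) l (𝓝 (inv1 g)) := by
  rw [tendsto_iff_X_pow_dvd] at h ⊢
  intro K
  filter_upwards [h K] with a ha
  have e : inv1 (f a) - inv1 g = (f a - g) * (-(inv1 (f a) * inv1 g)) := by
    linear_combination inv1 g * mul_inv1 (hf a) - inv1 (f a) * mul_inv1 hg
  rw [e]
  exact ha.mul_right _

/-- `1 / (q ^ c, q ^ c)_n`, extended by `0` to negative `n`. -/
noncomputable def iq (c : ℕ) (n : ℤ) : ℤ⟦X⟧ :=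
  if n < 0 then 0 else inv1 (qPoch (X ^ c) (X ^ c) n.toNat)

theorem iq_of_neg (c : ℕ) {n : ℤ} (h : n < 0) : iq c n = 0 := if_pos h

theorem iq_natCast (c n : ℕ) : iq c n = inv1 (qPoch (X ^ c) (X ^ c) n) := by simp [iq]

theorem qPoch_mul_iq {c : ℕ} (hc : 1 ≤ c) (n : ℕ) : qPoch (X ^ c) (X ^ c) n * iq c n = 1 := by
  rw [iq_natCast, mul_inv1 (constantCoeff_qPoch_X hc n)]

theorem iq_zero {c : ℕ} (hc : 1 ≤ c) : iq c 0 = 1 := by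
  simpa [qPoch] using qPoch_mul_iq hc 0

theorem qPoch_succ (c n : ℕ) :
    qPoch (X ^ c) (X ^ c) (n + 1) = qPoch (X ^ c) (X ^ c) n * (1 - X ^ (c * (n + 1))) := by
  rw [qPoch, Finset.prod_range_succ, ← qPoch]
  ring

/-- At `n = 0` both sides vanish, so the extension of `iq` by zero is compatible with the
recurrence; this is what lets the Pascal rules hold for every integer `k`. -/
theorem iq_sub_one {c : ℕ} (hc : 1 ≤ c) {n : ℤ} (h : 0 ≤ n) :
    iq c (n - 1) = (1 - xp (c * n)) * iq c n := by
  lift n to ℕ using h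
  rcases n with _ | n
  · simp [iq, xp]
  · have h1 := qPoch_mul_iq hc n
    have h2 := qPoch_mul_iq hc (n + 1)
    rw [qPoch_succ] at h2
    have e : xp (c * (n + 1 : ℕ)) = X ^ (c * (n + 1)) := by rw [← xp_natCast]; push_cast; rfl
    rw [e, show ((n + 1 : ℕ) : ℤ) - 1 = n by push_cast; ring]
    linear_combination (1 - X ^ (c * (n + 1))) * iq c (n + 1 : ℕ) * h1 - iq c n * h2

theorem tendsto_iq {c : ℕ} (hc : 1 ≤ c) : Tendsto (iq c) atTop (𝓝 (inv1 (eulerProd c))) := by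
  rw [← Nat.map_cast_int_atTop, tendsto_map'_iff]
  exact (tendsto_inv1 (constantCoeff_qPoch_X hc) (constantCoeff_eulerProd hc)
    (tendsto_qPoch hc)).congr fun n => (iq_natCast c n).symm

/-- The Gaussian binomial coefficient with base `q ^ c`. -/
noncomputable def gb (c n : ℕ) (k : ℤ) : ℤ⟦X⟧ := qPoch (X ^ c) (X ^ c) n * iq c k * iq c (n - k)

theorem gb_symm (c n : ℕ) (k : ℤ) : gb c n (n - k) = gb c n k := by
  rw [gb, gb, sub_sub_cancel]; ring

theorem gb_of_neg (c n : ℕ) {k : ℤ} (h : k < 0) : gb c n k = 0 := by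
  rw [gb, iq_of_neg c h]; ring

theorem gb_of_lt (c n : ℕ) {k : ℤ} (h : n < k) : gb c n k = 0 := by
  rw [gb, iq_of_neg c (by omega : (n : ℤ) - k < 0)]; ring

theorem gb_zero_zero {c : ℕ} (hc : 1 ≤ c) : gb c 0 0 = 1 := by
  simp [gb, iq_zero hc, qPoch]

/-- Over a common denominator, with Q = q^c, this q-Pascal rule is 1 - Q^(n+1) = (1 - Q^(n+1-k)) +
Q^(n+1-k) (1 - Q^k). Outside 0 ≤ k ≤ n+1 all terms vanish. -/
theorem gb_succ {c : ℕ} (hc : 1 ≤ c) (n : ℕ) (k : ℤ) :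
    gb c (n + 1) k = gb c n k + xp (c * (n + 1 - k)) * gb c n (k - 1) := by
  rcases lt_or_ge k 0 with hk | hk
  · rw [gb_of_neg _ _ hk, gb_of_neg _ _ hk, gb_of_neg _ _ (by omega : k - 1 < 0)]; ring
  rcases lt_or_ge ((n : ℤ) + 1) k with hk' | hk'
  · rw [gb_of_lt _ _ (by push_cast; omega), gb_of_lt _ _ (by omega : (n : ℤ) < k),
      gb_of_lt _ _ (by omega : (n : ℤ) < k - 1)]; ring
  have h1 := iq_sub_one hc hk
  have h2 := iq_sub_one hc (by omega : 0 ≤ (n : ℤ) + 1 - k)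
  have h3 : xp (c * (n + 1 - k)) * xp (c * k) = X ^ (c * (n + 1)) := by
    have hc0 : (0 : ℤ) ≤ c := by positivity
    rw [xp_mul (mul_nonneg hc0 (by omega)) (mul_nonneg hc0 hk), ← xp_natCast]
    congr 1; push_cast; ring
  simp only [gb, qPoch_succ]
  rw [show (n : ℤ) - k = n + 1 - k - 1 by ring, show (n : ℤ) - (k - 1) = n + 1 - k by ring, h1, h2]
  push_cast
  linear_combination qPoch (X ^ c) (X ^ c) n * iq c k * iq c (n + 1 - k) * h3

theorem gb_succ' {c : ℕ} (hc : 1 ≤ c) (n : ℕ) (k : ℤ) :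
    gb c (n + 1) k = gb c n (k - 1) + xp (c * k) * gb c n k := by
  rw [← gb_symm, gb_succ hc, ← gb_symm c n (k - 1), ← gb_symm c n k]
  push_cast
  ring_nf

theorem tendsto_gb {c : ℕ} (hc : 1 ≤ c) (k : ℤ) :
    Tendsto (fun n : ℕ => gb c n k) atTop (𝓝 (iq c k)) := by
  have h1 := ((tendsto_qPoch hc).mul_const (iq c k)).mul ((tendsto_iq hc).comp
    (tendsto_atTop_add_const_right _ (-k) (tendsto_natCast_atTop_atTop (R := ℤ))))
  have h2 := mul_inv1 (constantCoeff_eulerProd hc)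
  rw [show eulerProd c * iq c k * inv1 (eulerProd c) = iq c k by
    linear_combination iq c k * h2] at h1
  exact h1

theorem tendsto_gb_central {c : ℕ} (hc : 1 ≤ c) (j : ℤ) :
    Tendsto (fun n : ℕ => gb c (n + n) (n + j)) atTop (𝓝 (inv1 (eulerProd c))) := by
  have hn := tendsto_natCast_atTop_atTop (R := ℤ)
  have h1 := (((tendsto_qPoch hc).comp (tendsto_atTop_mono (fun n => Nat.le_add_left n n)
    tendsto_id)).mul ((tendsto_iq hc).comp (tendsto_atTop_add_const_right _ j hn))).mul
    ((tendsto_iq hc).comp (tendsto_atTop_add_const_right _ (-j) hn))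
  have h2 := mul_inv1 (constantCoeff_eulerProd hc)
  rw [show eulerProd c * inv1 (eulerProd c) * inv1 (eulerProd c) = inv1 (eulerProd c) by
    linear_combination inv1 (eulerProd c) * h2] at h1
  refine h1.congr fun n => ?_
  simp only [Function.comp, gb]
  congr 2
  push_cast; ring

theorem tsum_xp_mul_add {ι : Type*} {f : ι → ℤ} (hf : Tendsto f cofinite atTop) (g h : ι → ℤ⟦X⟧) :
    ∑' i, xp (f i) * (g i + h i) = ∑' i, xp (f i) * g i + ∑' i, xp (f i) * h i := by
  rw [← (summable_xp_mul hf g).tsum_add (summable_xp_mul hf h)]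
  simp only [mul_add]

theorem tsum_xp_mul_mul_right {ι : Type*} {f : ι → ℤ} (hf : Tendsto f cofinite atTop)
    (g : ι → ℤ⟦X⟧) (c : ℤ⟦X⟧) : ∑' i, xp (f i) * g i * c = (∑' i, xp (f i) * g i) * c :=
  (summable_xp_mul hf g).tsum_mul_right c

theorem tsum_mul_xp_mul_left {ι : Type*} {f : ι → ℤ} (hf : Tendsto f cofinite atTop)
    (g : ι → ℤ⟦X⟧) (c : ℤ⟦X⟧) : ∑' i, c * (xp (f i) * g i) = c * ∑' i, xp (f i) * g i :=
  (summable_xp_mul hf g).tsum_mul_left c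

/-! ### The Jacobi triple product -/

section Jacobi

variable {a b : ℕ} {e : ℤ → ℤ}

/-- Since j(j+1) and j(j-1) are nonnegative, a, b ≥ 1 give e(j) ≥ j^2. The bound serves twice: the
theta series converges, and no exponent is truncated by `xp`. -/
theorem abs_le_of_two_mul_eq (ha : 1 ≤ a) (hb : 1 ≤ b)
    (he : ∀ j, 2 * e j = a * (j * (j + 1)) + b * (j * (j - 1))) (j : ℤ) : |j| ≤ e j := by
  have h1 : 0 ≤ j * (j + 1) := by
    rcases lt_or_ge j 0 with h | h <;> nlinarith
  have h2 : 0 ≤ j * (j - 1) := by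
    rcases lt_or_ge j 1 with h | h <;> nlinarith
  have h3 := he j
  have h4 : |j| ≤ j ^ 2 := by
    rw [← sq_abs]
    rcases eq_or_ne j 0 with rfl | hj
    · simp
    · nlinarith [Int.one_le_abs hj]
  have ha' : (1 : ℤ) ≤ a := by exact_mod_cast ha
  have hb' : (1 : ℤ) ≤ b := by exact_mod_cast hb
  nlinarith

/-- The finite form of the Jacobi triple product. -/
theorem finite_triple_product (ha : 1 ≤ a) (hb : 1 ≤ b)
    (he : ∀ j, 2 * e j = a * (j * (j + 1)) + b * (j * (j - 1))) (M N : ℕ) :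
    ∑' j, xp (e j) * gb (a + b) (M + N) (N + j) =
      (∏ k ∈ Finset.range M, (1 + X ^ (a + (a + b) * k))) *
        ∏ k ∈ Finset.range N, (1 + X ^ (b + (a + b) * k)) := by
  have hc : 1 ≤ a + b := by omega
  have habs := abs_le_of_two_mul_eq ha hb he
  have hf := tendsto_cofinite_of_abs_le habs
  have he0 : ∀ j, 0 ≤ e j := fun j => (abs_nonneg j).trans (habs j)
  have hstep : ∀ j, e (j + 1) = e j + a * (j + 1) + b * j := fun j => by
    linarith [he j, he (j + 1)]
  induction M with
  | zero =>
    induction N with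
    | zero =>
      rw [tsum_eq_single 0]
      · have h0 : e 0 = 0 := by linarith [he 0]
        simp [h0, xp_zero, gb_zero_zero hc]
      · intro j hj
        rcases lt_or_gt_of_ne hj with h | h
        · rw [gb_of_neg _ _ (by simpa using h), mul_zero]
        · rw [gb_of_lt _ _ (by simpa using h), mul_zero]
    | succ N ih =>
      rw [Finset.prod_range_succ, ← mul_assoc, ← ih, mul_add, mul_one, ← tsum_xp_mul_mul_right hf]
      have h1 : ∀ j, gb (a + b) (0 + (N + 1)) ((N + 1 : ℕ) + j) =
          gb (a + b) (0 + N) (N + j) +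
            xp ((a + b : ℕ) * (N + 1 + j)) * gb (a + b) (0 + N) (N + (j + 1)) := fun j => by
        rw [← add_assoc 0 N 1, gb_succ' hc]
        push_cast
        ring_nf
      simp only [h1]
      -- The second Pascal term becomes the old sum times q^(b+(a+b)N) after shifting j by one,
      -- because e(j+1) = e(j) + a(j+1) + bj.
      rw [tsum_xp_mul_add hf, ← (Equiv.addRight (1 : ℤ)).tsum_eq
        (fun j => xp (e j) * gb (a + b) (0 + N) (N + j) * X ^ (b + (a + b) * N))]
      congr 1
      refine tsum_congr fun j => ?_
      simp only [Equiv.coe_addRight]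
      rcases lt_or_ge (N + (j + 1)) 0 with h | h
      · rw [gb_of_neg _ _ h]; ring
      rw [← mul_assoc, xp_mul (he0 j) (mul_nonneg (by positivity) (by omega)), mul_right_comm,
        ← xp_natCast, xp_mul (he0 _) (by positivity), hstep]
      congr 2
      push_cast; ring
  | succ M ih =>
    rw [Finset.prod_range_succ, mul_right_comm, ← ih, mul_add, mul_one, ← tsum_xp_mul_mul_right hf]
    have h1 : ∀ j, gb (a + b) (M + 1 + N) (N + j) =
        gb (a + b) (M + N) (N + j) +
          xp ((a + b : ℕ) * (M + 1 - j)) * gb (a + b) (M + N) (N + (j - 1)) := fun j => by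
      rw [add_right_comm, gb_succ hc]
      push_cast
      ring_nf
    simp only [h1]
    rw [tsum_xp_mul_add hf, ← (Equiv.addRight (1 : ℤ)).tsum_eq
      (fun j => xp (e j) * (xp ((a + b : ℕ) * (M + 1 - j)) * gb (a + b) (M + N) (N + (j - 1))))]
    congr 1
    refine tsum_congr fun j => ?_
    simp only [Equiv.coe_addRight, add_sub_cancel_right]
    rcases lt_or_ge (M : ℤ) j with h | h
    · rw [gb_of_lt _ _ (by push_cast; omega)]; ring
    rw [← mul_assoc, xp_mul (he0 _) (mul_nonneg (by positivity) (by omega)), mul_right_comm,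
      ← xp_natCast, xp_mul (he0 _) (by positivity), hstep]
    congr 2
    push_cast; ring

/-- The Jacobi triple product. -/
theorem tendsto_triple_product (ha : 1 ≤ a) (hb : 1 ≤ b)
    (he : ∀ j, 2 * e j = a * (j * (j + 1)) + b * (j * (j - 1))) :
    Tendsto (fun N : ℕ => (∏ k ∈ Finset.range N, (1 + X ^ (a + (a + b) * k))) *
        (∏ k ∈ Finset.range N, (1 + X ^ (b + (a + b) * k))) *
        qPoch (X ^ (a + b)) (X ^ (a + b)) N) atTop (𝓝 (∑' j, xp (e j))) := by
  have hc : 1 ≤ a + b := by omega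
  have hf := tendsto_cofinite_of_abs_le (abs_le_of_two_mul_eq ha hb he)
  have h1 := (tendsto_tsum_xp_mul hf fun j => tendsto_gb_central hc j).mul (tendsto_qPoch hc)
  simp only [finite_triple_product ha hb he] at h1
  rwa [(summable_xp hf).tsum_mul_right, mul_assoc, mul_comm (inv1 _),
    mul_inv1 (constantCoeff_eulerProd hc), mul_one] at h1

end Jacobi

/-! ### The Durfee rectangle identity -/

theorem tendsto_mul_add (s : ℕ) : Tendsto (fun n : ℕ => (n : ℤ) * (n + s)) cofinite atTop :=
  tendsto_cofinite_of_natCast_le fun n => by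
    rcases n with _ | n
    · simp
    · push_cast; nlinarith

/-- A q-Vandermonde sum, by induction on `M` with `s` free. Pascal's rule leaves the case (M, s)
plus, after n ↦ n+1, q^(M+1+s) times the case (M, s+1); `iq_sub_one` adds the two. -/
theorem tsum_durfee_finite (M s : ℕ) :
    ∑' n : ℕ, xp (n * (n + s)) * (gb 1 M n * iq 1 (n + s)) = iq 1 (M + s) := by
  have hf := tendsto_mul_add
  induction M generalizing s with
  | zero =>
    rw [tsum_eq_single 0]
    · simp [xp_zero, gb_zero_zero]
    · intro n hn
      rw [gb_of_lt _ _ (by exact_mod_cast Nat.pos_of_ne_zero hn)]; ring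
  | succ M ih =>
    have h1 : ∀ n : ℕ, gb 1 (M + 1) n * iq 1 (n + s) = gb 1 M n * iq 1 (n + s) +
        xp (M + 1 - n) * gb 1 M (n - 1) * iq 1 (n + s) := fun n => by
      rw [gb_succ le_rfl]; push_cast; ring_nf
    simp only [h1]
    rw [tsum_xp_mul_add (hf s), ih,
      (summable_xp_mul (hf s) _).tsum_eq_zero_add]
    have h2 : ∀ n : ℕ, xp ((n + 1 : ℕ) * ((n + 1 : ℕ) + s)) * (xp (M + 1 - (n + 1 : ℕ)) *
        gb 1 M ((n + 1 : ℕ) - 1) * iq 1 ((n + 1 : ℕ) + s)) =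
        xp (M + 1 + s) * (xp (n * (n + (s + 1 : ℕ))) * (gb 1 M n * iq 1 (n + (s + 1 : ℕ)))) := by
      intro n
      push_cast
      rw [add_sub_cancel_right, show (n : ℤ) + 1 + s = n + (s + 1) by ring]
      rcases lt_or_ge M n with h | h
      · rw [gb_of_lt _ _ (by exact_mod_cast h)]; ring
      have h3 : xp ((n + 1) * (n + (s + 1))) * xp (M + 1 - (n + 1)) =
          xp (M + 1 + s) * xp (n * (n + (s + 1))) := by
        rw [xp_mul (by positivity) (by omega), xp_mul (by positivity) (by positivity)]
        congr 1; ring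
      linear_combination (gb 1 M n * iq 1 (n + (s + 1))) * h3
    simp only [h2]
    rw [tsum_mul_xp_mul_left (hf _), ih, gb_of_neg _ _ (by simp : ((0 : ℕ) : ℤ) - 1 < 0)]
    have h4 := iq_sub_one le_rfl (by positivity : (0 : ℤ) ≤ M + 1 + s) (c := 1)
    push_cast at h4 ⊢
    rw [show (M : ℤ) + 1 + s - 1 = M + s by ring, one_mul] at h4
    rw [show (M : ℤ) + (s + 1) = M + 1 + s by ring]
    linear_combination h4

/-- The Durfee rectangle identity. -/
theorem tsum_durfee (s : ℕ) :
    ∑' n : ℕ, xp (n * (n + s)) * (iq 1 n * iq 1 (n + s)) = inv1 (eulerProd 1) := by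
  have hf := tendsto_mul_add s
  have h1 := tendsto_tsum_xp_mul hf fun n : ℕ => (tendsto_gb le_rfl n).mul_const (iq 1 (n + s))
  simp only [tsum_durfee_finite] at h1
  refine tendsto_nhds_unique h1 ((tendsto_iq le_rfl).comp ?_)
  exact tendsto_atTop_add_const_right _ (s : ℤ) (tendsto_natCast_atTop_atTop (R := ℤ))

/-- Terms with n < r vanish, and n ↦ n + r turns the rest into the Durfee identity with s = 2r + t.
-/
theorem tsum_xp_mul_iq_mul_iq {r t : ℤ} (hr : 0 ≤ r) (ht : 0 ≤ t) :
    ∑' n : ℕ, xp (n ^ 2 + t * n) * (iq 1 (n - r) * iq 1 (n + r + t)) =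
      xp (r ^ 2 + t * r) * inv1 (eulerProd 1) := by
  lift r to ℕ using hr
  lift t to ℕ using ht
  rw [← tsum_durfee (2 * r + t), ← tsum_mul_xp_mul_left (tendsto_mul_add _),
    ← (add_left_injective r).tsum_eq]
  · refine tsum_congr fun n => ?_
    rw [← mul_assoc (xp (r ^ 2 + t * r)), xp_mul (by positivity) (by positivity)]
    push_cast
    ring_nf
  · intro n hn
    rw [Function.mem_support] at hn
    by_contra h
    refine hn ?_
    rw [iq_of_neg 1 (n := n - r)]
    · ring
    · by_contra h'
      exact h ⟨n - r, by simp only; omega⟩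

theorem tsum_sq_mul_iq (r : ℤ) :
    ∑' n : ℕ, xp (n ^ 2) * (iq 1 (n - r) * iq 1 (n + r)) = xp (r ^ 2) * inv1 (eulerProd 1) := by
  wlog h : 0 ≤ r generalizing r
  · have := this (-r) (by omega)
    simpa [mul_comm, ← sub_eq_add_neg, add_comm] using this
  · simpa using tsum_xp_mul_iq_mul_iq (t := 0) h le_rfl

theorem tsum_sq_add_mul_iq (r : ℤ) :
    ∑' n : ℕ, xp (n ^ 2 + n) * (iq 1 (n - r) * iq 1 (n + 1 + r)) =
      xp (r ^ 2 + r) * inv1 (eulerProd 1) := by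
  wlog h : 0 ≤ r generalizing r
  -- The reflection r ↦ -1 - r exchanges the two `iq` factors and fixes r^2 + r.
  · have := this (-1 - r) (by omega)
    rw [show (-1 - r) ^ 2 + (-1 - r) = r ^ 2 + r by ring] at this
    rw [← this]
    refine tsum_congr fun n => ?_
    ring_nf
  · have := tsum_xp_mul_iq_mul_iq (r := r) (t := 1) h (by norm_num)
    rw [one_mul] at this
    rw [← this]
    refine tsum_congr fun n => ?_
    ring_nf

theorem tsum_xp_mul_comm {ι κ : Type*} {f : ι → ℤ} {g : κ → ℤ} (hf : Tendsto f cofinite atTop)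
    (hg : Tendsto g cofinite atTop) (hf0 : ∀ i, 0 ≤ f i) (hg0 : ∀ k, 0 ≤ g k)
    (h : ι → κ → ℤ⟦X⟧) :
    ∑' i, xp (f i) * ∑' k, xp (g k) * h i k = ∑' k, xp (g k) * ∑' i, xp (f i) * h i k := by
  have h1 : Summable (Function.uncurry fun i k => xp (f i) * (xp (g k) * h i k)) := by
    refine (summable_xp_mul (tendsto_cofinite_add hf hg hf0 hg0) fun p => h p.1 p.2).congr ?_
    rintro ⟨i, k⟩
    simp only [Function.uncurry]
    rw [← xp_mul (hf0 i) (hg0 k), mul_assoc]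
  simp only [← tsum_mul_xp_mul_left hf, ← tsum_mul_xp_mul_left hg]
  rw [← h1.tsum_comm]
  refine tsum_congr fun k => tsum_congr fun i => ?_
  ring

/-! ### Rogers–Schur sums of Gaussian binomials -/

theorem tendsto_quadratic {a b c : ℤ} (h : |b| + 1 ≤ a) (hc : 0 ≤ c) :
    Tendsto (fun j : ℤ => a * j ^ 2 + b * j + c) cofinite atTop :=
  tendsto_cofinite_of_abs_le (abs_le_quadratic h hc)

theorem tendsto_six_one : Tendsto (fun r : ℤ => 6 * r ^ 2 + r) cofinite atTop := by
  simpa using tendsto_quadratic (a := 6) (b := 1) (c := 0) (by norm_num) le_rfl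

theorem six_one_nonneg (r : ℤ) : 0 ≤ 6 * r ^ 2 + r := by nlinarith

theorem tendsto_six_four : Tendsto (fun r : ℤ => 6 * r ^ 2 + 4 * r) cofinite atTop := by
  simpa using tendsto_quadratic (a := 6) (b := 4) (c := 0) (by norm_num) le_rfl

theorem six_four_nonneg (r : ℤ) : 0 ≤ 6 * r ^ 2 + 4 * r := by
  rcases lt_or_ge r 0 with h | h <;> nlinarith

theorem tendsto_six_five : Tendsto (fun r : ℤ => 6 * r ^ 2 + 5 * r + 1) cofinite atTop :=
  tendsto_quadratic (a := 6) (b := 5) (c := 1) (by norm_num) (by norm_num)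

theorem six_five_nonneg (r : ℤ) : 0 ≤ 6 * r ^ 2 + 5 * r + 1 := by
  rcases lt_or_ge r 0 with h | h <;> nlinarith

/-- Compares terms at complementary indices `k` and `k'`. The exponents `b`, `b'` need only be
nonnegative for 0 ≤ k ≤ n, since elsewhere the Gaussian binomial kills whatever truncation does. -/
theorem xp_mul_gb_congr {a b a' b' : ℤ} {n : ℕ} {k k' : ℤ} (hk : k + k' = n)
    (h : a + b = a' + b') (ha : 0 ≤ a) (ha' : 0 ≤ a') (hb : 0 ≤ k → k ≤ n → 0 ≤ b)
    (hb' : 0 ≤ k → k ≤ n → 0 ≤ b') :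
    xp a * (xp b * gb 1 n k) = xp a' * (xp b' * gb 1 n k') := by
  obtain rfl : k' = n - k := by omega
  rw [gb_symm]
  rcases lt_or_ge k 0 with h1 | h1
  · rw [gb_of_neg _ _ h1]; ring
  rcases lt_or_ge (n : ℤ) k with h2 | h2
  · rw [gb_of_lt _ _ h2]; ring
  rw [← mul_assoc, ← mul_assoc, xp_mul ha (hb h1 h2), xp_mul ha' (hb' h1 h2), h]

/-- The alternating sum of Gaussian binomial coefficients of Rogers and Schur. -/
noncomputable def gbSum (N : ℕ) (n : ℤ) : ℤ⟦X⟧ :=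
  ∑' r : ℤ, xp (6 * r ^ 2 + r) * gb 1 N (n - 3 * r) -
    ∑' r : ℤ, xp (6 * r ^ 2 + 5 * r + 1) * gb 1 N (n - 3 * r - 1)

/-- The extra terms from Pascal's rule in the two sums cancel under r ↦ -1 - r. In `gbSum_even` the
other Pascal rule is used, and the cancellation is under r ↦ -r. -/
theorem gbSum_odd (n : ℕ) : gbSum (2 * n + 1) n = gbSum (2 * n) n := by
  have h1 : ∀ k : ℤ, gb 1 (2 * n + 1) k =
      gb 1 (2 * n) k + xp (2 * n + 1 - k) * gb 1 (2 * n) (k - 1) := fun k => by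
    rw [gb_succ le_rfl]; push_cast; ring_nf
  have h2 : ∑' r : ℤ, xp (6 * r ^ 2 + r) *
        (xp (2 * n + 1 - (n - 3 * r)) * gb 1 (2 * n) (n - 3 * r - 1)) =
      ∑' r : ℤ, xp (6 * r ^ 2 + 5 * r + 1) *
        (xp (2 * n + 1 - (n - 3 * r - 1)) * gb 1 (2 * n) (n - 3 * r - 1 - 1)) := by
    rw [← (Equiv.subLeft (-1 : ℤ)).tsum_eq]
    refine tsum_congr fun r => ?_
    simp only [Equiv.subLeft_apply]
    refine xp_mul_gb_congr (by push_cast; ring) (by ring) (six_one_nonneg _)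
      (six_five_nonneg _) ?_ ?_
    all_goals (intros; push_cast at *; omega)
  simp only [gbSum, h1]
  rw [tsum_xp_mul_add tendsto_six_one, tsum_xp_mul_add tendsto_six_five, h2]
  ring

theorem gbSum_even (n : ℕ) : gbSum (2 * n + 2) (n + 1) = gbSum (2 * n + 1) n := by
  have h1 : ∀ k : ℤ, gb 1 (2 * n + 2) k =
      gb 1 (2 * n + 1) (k - 1) + xp k * gb 1 (2 * n + 1) k := fun k => by
    rw [gb_succ' le_rfl]; push_cast; ring_nf
  have h2 : ∑' r : ℤ, xp (6 * r ^ 2 + r) *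
        (xp (n + 1 - 3 * r) * gb 1 (2 * n + 1) (n + 1 - 3 * r)) =
      ∑' r : ℤ, xp (6 * r ^ 2 + 5 * r + 1) *
        (xp (n + 1 - 3 * r - 1) * gb 1 (2 * n + 1) (n + 1 - 3 * r - 1)) := by
    rw [← (Equiv.neg ℤ).tsum_eq]
    refine tsum_congr fun r => ?_
    simp only [Equiv.neg_apply]
    refine xp_mul_gb_congr (by push_cast; ring) (by ring) (six_one_nonneg _)
      (six_five_nonneg _) ?_ ?_
    all_goals (intros; push_cast at *; omega)
  simp only [gbSum, h1]
  rw [tsum_xp_mul_add tendsto_six_one, tsum_xp_mul_add tendsto_six_five, h2]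
  simp only [show ∀ r : ℤ, (n : ℤ) + 1 - 3 * r - 1 = n - 3 * r from fun r => by ring]
  ring

theorem gbSum_eq_one (n : ℕ) : gbSum (2 * n) n = 1 := by
  induction n with
  | zero =>
    have h1 : ∀ r : ℤ, r ≠ 0 → xp (6 * r ^ 2 + r) * gb 1 0 (0 - 3 * r) = 0 := by
      intro r hr
      rcases lt_or_gt_of_ne hr with h | h
      · rw [gb_of_lt _ _ (by push_cast; omega), mul_zero]
      · rw [gb_of_neg _ _ (by omega), mul_zero]
    have h2 : ∀ r : ℤ, xp (6 * r ^ 2 + 5 * r + 1) * gb 1 0 (0 - 3 * r - 1) = 0 := by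
      intro r
      rcases lt_or_ge r 0 with h | h
      · rw [gb_of_lt _ _ (by push_cast; omega), mul_zero]
      · rw [gb_of_neg _ _ (by omega), mul_zero]
    simp only [gbSum, mul_zero, Nat.cast_zero, h2]
    rw [tsum_eq_single 0 h1]
    simp [xp_zero, gb_zero_zero]
  | succ n ih =>
    rw [mul_add, Nat.cast_add, Nat.cast_one, mul_one, gbSum_even, gbSum_odd, ih]

/-- Applying a different Pascal rule to each sum makes the terms gb(2n, n-3r-1) cancel; what is left
is q^n times `gbSum (2 * n) n`, which is 1. -/
theorem xp_eq_tsum_gb (n : ℕ) :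
    ∑' r : ℤ, xp (6 * r ^ 2 + 4 * r) * gb 1 (2 * n + 1) (n - 3 * r) -
      ∑' r : ℤ, xp (6 * r ^ 2 + 4 * r) * gb 1 (2 * n + 1) (n - 3 * r - 1) = xp n := by
  have h1 : ∀ k : ℤ, gb 1 (2 * n + 1) k =
      gb 1 (2 * n) k + xp (2 * n + 1 - k) * gb 1 (2 * n) (k - 1) := fun k => by
    rw [gb_succ le_rfl]; push_cast; ring_nf
  have h2 : ∀ k : ℤ, gb 1 (2 * n + 1) k =
      gb 1 (2 * n) (k - 1) + xp k * gb 1 (2 * n) k := fun k => by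
    rw [gb_succ' le_rfl]; push_cast; ring_nf
  have h3 : ∑' r : ℤ, xp (6 * r ^ 2 + 4 * r) * (xp (n - 3 * r) * gb 1 (2 * n) (n - 3 * r)) =
      xp n * ∑' r : ℤ, xp (6 * r ^ 2 + r) * gb 1 (2 * n) (n - 3 * r) := by
    rw [← tsum_mul_xp_mul_left tendsto_six_one]
    refine tsum_congr fun r => ?_
    -- The indices already agree, while `xp_mul_gb_congr` expects complementary ones.
    conv_rhs => rw [← gb_symm]
    refine xp_mul_gb_congr (by push_cast; ring) (by ring) (six_four_nonneg _) (by positivity) ?_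
      fun _ _ => six_one_nonneg _
    intros; push_cast at *; omega
  have h4 : ∑' r : ℤ, xp (6 * r ^ 2 + 4 * r) *
        (xp (2 * n + 1 - (n - 3 * r - 1)) * gb 1 (2 * n) (n - 3 * r - 1 - 1)) =
      xp n * ∑' r : ℤ, xp (6 * r ^ 2 + 5 * r + 1) * gb 1 (2 * n) (n - 3 * r - 1) := by
    rw [← tsum_mul_xp_mul_left tendsto_six_five, ← (Equiv.subLeft (-1 : ℤ)).tsum_eq]
    refine tsum_congr fun r => ?_
    simp only [Equiv.subLeft_apply]
    refine xp_mul_gb_congr (by push_cast; ring) (by ring) (six_four_nonneg _) (by positivity) ?_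
      fun _ _ => six_five_nonneg _
    intros; push_cast at *; omega
  have h5 : ∑' r : ℤ, xp (6 * r ^ 2 + 4 * r) * gb 1 (2 * n + 1) (n - 3 * r) =
      ∑' r : ℤ, xp (6 * r ^ 2 + 4 * r) * (gb 1 (2 * n) (n - 3 * r - 1) +
        xp (n - 3 * r) * gb 1 (2 * n) (n - 3 * r)) := tsum_congr fun r => by rw [h2]
  have h6 := gbSum_eq_one n
  rw [gbSum] at h6
  rw [h5]
  simp only [h1]
  rw [tsum_xp_mul_add tendsto_six_four, tsum_xp_mul_add tendsto_six_four, h3, h4]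
  linear_combination xp n * h6

theorem tsum_gb_mul_iq {f : ℤ → ℤ} (hf : Tendsto f cofinite atTop) (N : ℕ) (k : ℤ → ℤ) :
    (∑' r, xp (f r) * gb 1 N (k r)) * iq 1 N = ∑' r, xp (f r) * (iq 1 (k r) * iq 1 (N - k r)) := by
  rw [← tsum_xp_mul_mul_right hf]
  refine tsum_congr fun r => ?_
  rw [gb]
  linear_combination xp (f r) * (iq 1 (k r) * iq 1 (N - k r)) * qPoch_mul_iq le_rfl N

/-- Dividing `gbSum_eq_one` by (q)_{2n} gives a Bailey pair relative to 1, supported at 3r and 3r+1.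
`xp_mul_iq_odd` is the analogue relative to q. -/
theorem iq_even (n : ℕ) : iq 1 (2 * n : ℕ) =
    ∑' r : ℤ, xp (6 * r ^ 2 + r) * (iq 1 (n - 3 * r) * iq 1 (n + 3 * r)) -
      ∑' r : ℤ, xp (6 * r ^ 2 + 5 * r + 1) * (iq 1 (n - (3 * r + 1)) * iq 1 (n + (3 * r + 1))) := by
  have h1 := gbSum_eq_one n
  rw [gbSum] at h1
  rw [← one_mul (iq 1 _), ← h1, sub_mul, tsum_gb_mul_iq tendsto_six_one,
    tsum_gb_mul_iq tendsto_six_five]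
  congr 1 <;> refine tsum_congr fun r => ?_ <;> congr 3 <;> push_cast <;> ring

theorem xp_mul_iq_odd (n : ℕ) : xp n * iq 1 (2 * n + 1 : ℕ) =
    ∑' r : ℤ, xp (6 * r ^ 2 + 4 * r) * (iq 1 (n - 3 * r) * iq 1 (n + 1 + 3 * r)) -
      ∑' r : ℤ, xp (6 * r ^ 2 + 4 * r) *
        (iq 1 (n - (3 * r + 1)) * iq 1 (n + 1 + (3 * r + 1))) := by
  rw [← xp_eq_tsum_gb n, sub_mul, tsum_gb_mul_iq tendsto_six_four,
    tsum_gb_mul_iq tendsto_six_four]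
  congr 1 <;> refine tsum_congr fun r => ?_ <;> congr 3 <;> push_cast <;> ring

/-! ### Bailey's lemma and Slater's identities -/

/-- After interchanging the sums, the inner sum over n is evaluated by `hh` (a Durfee identity in
the applications), and the outer sum becomes a theta series with exponents g + s. -/
theorem tsum_bailey {f : ℕ → ℤ} {g s : ℤ → ℤ} {h : ℕ → ℤ → ℤ⟦X⟧} {p : ℤ → ℤ} {c : ℤ⟦X⟧}
    (hf : Tendsto f cofinite atTop) (hg : Tendsto g cofinite atTop) (hf0 : ∀ i, 0 ≤ f i)
    (hg0 : ∀ k, 0 ≤ g k) (hs : ∀ r, 0 ≤ s r) (hp : Tendsto p cofinite atTop)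
    (hgs : ∀ r, g r + s r = p r)
    (hh : ∀ r, ∑' n, xp (f n) * h n r = xp (s r) * c) :
    ∑' n, xp (f n) * ∑' r, xp (g r) * h n r = (∑' r, xp (p r)) * c := by
  rw [tsum_xp_mul_comm hf hg hf0 hg0, ← (summable_xp hp).tsum_mul_right]
  refine tsum_congr fun r => ?_
  rw [hh, ← mul_assoc, xp_mul (hg0 r) (hs r), hgs]

theorem tsum_xp_mul_sub {ι : Type*} {f : ι → ℤ} (hf : Tendsto f cofinite atTop) (g h : ι → ℤ⟦X⟧) :
    ∑' i, xp (f i) * (g i - h i) = ∑' i, xp (f i) * g i - ∑' i, xp (f i) * h i := by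
  rw [← (summable_xp_mul hf g).tsum_sub (summable_xp_mul hf h)]
  simp only [mul_sub]

/-- Slater's identity for `∑ q ^ (n ^ 2) / (q)_{2 n}`, in the form of a difference of theta
series. -/
theorem tsum_sq_iq_even : ∑' n : ℕ, xp (n ^ 2) * iq 1 (2 * n : ℕ) =
    (∑' r : ℤ, xp (15 * r ^ 2 + r) - ∑' r : ℤ, xp (15 * r ^ 2 + 11 * r + 2)) *
      inv1 (eulerProd 1) := by
  have hf : Tendsto (fun n : ℕ => (n : ℤ) ^ 2) cofinite atTop :=
    tendsto_cofinite_of_natCast_le fun n => by exact_mod_cast Nat.le_self_pow two_ne_zero n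
  have hf0 : ∀ n : ℕ, 0 ≤ (n : ℤ) ^ 2 := fun n => by positivity
  simp only [iq_even]
  rw [tsum_xp_mul_sub hf, sub_mul]
  congr 1
  · refine tsum_bailey hf tendsto_six_one hf0 six_one_nonneg
      (s := fun r => (3 * r) ^ 2) (fun r => by positivity) ?_ (fun r => by ring)
      fun r => tsum_sq_mul_iq _
    simpa using tendsto_quadratic (a := 15) (b := 1) (c := 0) (by norm_num) le_rfl
  · refine tsum_bailey hf tendsto_six_five hf0 six_five_nonneg
      (s := fun r => (3 * r + 1) ^ 2) (fun r => by positivity) ?_ (fun r => by ring)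
      fun r => tsum_sq_mul_iq _
    exact tendsto_quadratic (a := 15) (b := 11) (c := 2) (by norm_num) (by norm_num)

/-- Slater's identity for `∑ q ^ (n ^ 2 + 2 n) / (q)_{2 n + 1}`, in the form of a difference of
theta series. -/
theorem tsum_sq_iq_odd : ∑' n : ℕ, xp (n ^ 2 + 2 * n) * iq 1 (2 * n + 1 : ℕ) =
    (∑' r : ℤ, xp (15 * r ^ 2 + 7 * r) - ∑' r : ℤ, xp (15 * r ^ 2 + 13 * r + 2)) *
      inv1 (eulerProd 1) := by
  have hf : Tendsto (fun n : ℕ => (n : ℤ) ^ 2 + n) cofinite atTop :=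
    tendsto_cofinite_of_natCast_le fun n => by nlinarith
  have hf0 : ∀ n : ℕ, 0 ≤ (n : ℤ) ^ 2 + n := fun n => by positivity
  have hs : ∀ r : ℤ, 0 ≤ r ^ 2 + r := fun r => by
    rcases lt_or_ge r 0 with h | h <;> nlinarith
  -- One factor q^n is split off because the expansion available is that of q^n / (q)_{2n+1}.
  have h1 : ∀ n : ℕ, xp (n ^ 2 + 2 * n) * iq 1 (2 * n + 1 : ℕ) =
      xp (n ^ 2 + n) * (xp n * iq 1 (2 * n + 1 : ℕ)) := fun n => by
    rw [← mul_assoc, xp_mul (hf0 n) (by positivity)]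
    ring_nf
  simp only [h1, xp_mul_iq_odd]
  rw [tsum_xp_mul_sub hf, sub_mul]
  congr 1
  · refine tsum_bailey hf tendsto_six_four hf0 six_four_nonneg
      (s := fun r => (3 * r) ^ 2 + 3 * r) (fun r => hs _) ?_ (fun r => by ring)
      fun r => tsum_sq_add_mul_iq _
    simpa using tendsto_quadratic (a := 15) (b := 7) (c := 0) (by norm_num) le_rfl
  · refine tsum_bailey hf tendsto_six_four hf0 six_four_nonneg
      (s := fun r => (3 * r + 1) ^ 2 + (3 * r + 1)) (fun r => hs _) ?_ (fun r => by ring)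
      fun r => tsum_sq_add_mul_iq _
    exact tendsto_quadratic (a := 15) (b := 13) (c := 2) (by norm_num) (by norm_num)

/-! ### Ramanujan's degree five identity for ψ -/

/-- Ramanujan's theta function `ψ(q)`, as a bilateral sum. -/
noncomputable def thetaPsi : ℤ⟦X⟧ := ∑' j : ℤ, xp (2 * j ^ 2 - j)

theorem tendsto_two_one : Tendsto (fun j : ℤ => 2 * j ^ 2 - j) cofinite atTop := by
  simpa [← sub_eq_add_neg] using
    tendsto_quadratic (a := 2) (b := -1) (c := 0) (by norm_num) le_rfl

theorem two_one_nonneg (j : ℤ) : 0 ≤ 2 * j ^ 2 - j := by nlinarith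

theorem tendsto_ten_five : Tendsto (fun j : ℤ => 5 * (2 * j ^ 2 - j)) cofinite atTop :=
  tendsto_atTop_mono (fun j => by linarith [two_one_nonneg j]) tendsto_two_one

theorem two_mul_five_three (j : ℤ) : 2 * ((5 * j ^ 2 - 3 * j) / 2) = 5 * j ^ 2 - 3 * j := by
  rcases Int.even_or_odd' j with ⟨m, rfl | rfl⟩
  · rw [show 5 * (2 * m) ^ 2 - 3 * (2 * m) = 2 * (10 * m ^ 2 - 3 * m) by ring]; omega
  · rw [show 5 * (2 * m + 1) ^ 2 - 3 * (2 * m + 1) = 2 * (10 * m ^ 2 + 7 * m + 1) by ring]; omega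

theorem two_mul_five_one (j : ℤ) : 2 * ((5 * j ^ 2 - j) / 2) = 5 * j ^ 2 - j := by
  rcases Int.even_or_odd' j with ⟨m, rfl | rfl⟩
  · rw [show 5 * (2 * m) ^ 2 - (2 * m) = 2 * (10 * m ^ 2 - m) by ring]; omega
  · rw [show 5 * (2 * m + 1) ^ 2 - (2 * m + 1) = 2 * (10 * m ^ 2 + 9 * m + 2) by ring]; omega

theorem two_mul_five_three_eq (j : ℤ) : 2 * ((5 * j ^ 2 - 3 * j) / 2) =
    (1 : ℕ) * (j * (j + 1)) + (4 : ℕ) * (j * (j - 1)) := by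
  rw [two_mul_five_three]; push_cast; ring

theorem two_mul_five_one_eq (j : ℤ) : 2 * ((5 * j ^ 2 - j) / 2) =
    (2 : ℕ) * (j * (j + 1)) + (3 : ℕ) * (j * (j - 1)) := by
  rw [two_mul_five_one]; push_cast; ring

theorem tsum_xp_mul_tsum_xp {ι κ : Type*} {f : ι → ℤ} {g : κ → ℤ} (hf : Tendsto f cofinite atTop)
    (hg : Tendsto g cofinite atTop) (hf0 : ∀ i, 0 ≤ f i) (hg0 : ∀ k, 0 ≤ g k) :
    (∑' i, xp (f i)) * ∑' k, xp (g k) = ∑' p : ι × κ, xp (f p.1 + g p.2) := by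
  have h : ∀ p : ι × κ, xp (f p.1 + g p.2) = xp (f p.1) * xp (g p.2) := fun p =>
    (xp_mul (hf0 _) (hg0 _)).symm
  rw [(summable_xp hf).tsum_mul_tsum (summable_xp hg)]
  · simp only [h]
  · simpa only [h] using summable_xp (tendsto_cofinite_add hf hg hf0 hg0)

/-- Multiplication by `(2 ± i) / 5` on Gaussian integers with both coordinates odd, in the
coordinates given by residue classes modulo `4` and `10`. -/
def gaussMap : (ℤ × ℤ) ⊕ (ℤ × ℤ) → ℤ × ℤ
  | .inl (a, b) =>
    if a % 2 = 0 then
      if b % 2 = 0 then (b + a / 2, a - b / 2) else ((1 - 2 * a + b) / 2, b + a / 2)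
    else
      if b % 2 = 0 then (a - b / 2, (1 - 2 * b - a) / 2)
      else ((1 - 2 * b - a) / 2, (1 - 2 * a + b) / 2)
  | .inr (i, j) => (2 * i - j, 1 - 2 * j - i)

/-- Put x = 4i-1, y = 4j-1, so that ψ(q)^2 has exponents E with x^2 + y^2 = 8E + 2. Then (2+i)(x+iy)
has coordinates 2x-y and x+2y, with 2x-y ≡ 2(x+2y) modulo 5. Either 5 divides both, giving the `inr`
block, or up to sign and order they are uniquely 10a-3 and 10b-1, giving the `inl` block. -/
theorem gaussMap_bijective : Function.Bijective gaussMap := by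
  constructor
  · rintro (⟨a, b⟩ | ⟨a, b⟩) (⟨c, d⟩ | ⟨c, d⟩) h <;> simp only [gaussMap] at h <;>
      (try split_ifs at h) <;>
      simp only [Prod.mk.injEq, Sum.inl.injEq, Sum.inr.injEq, reduceCtorEq] at h ⊢ <;> omega
  · rintro ⟨i, j⟩
    -- The quantity is -(x+2y), and 1 - 8i + 4j below is -(2x-y).
    have h5 : (3 - 4 * i - 8 * j) % 5 = 0 ∨ (3 - 4 * i - 8 * j) % 5 = 1 ∨
        (3 - 4 * i - 8 * j) % 5 = 2 ∨ (3 - 4 * i - 8 * j) % 5 = 3 ∨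
        (3 - 4 * i - 8 * j) % 5 = 4 := by omega
    rcases h5 with h | h | h | h | h
    · refine ⟨.inr ((1 - (1 - 8 * i + 4 * j) / 5) / 4, (1 + (3 - 4 * i - 8 * j) / 5) / 4), ?_⟩
      simp only [gaussMap, Prod.mk.injEq]
      omega
    · refine ⟨.inl ((3 + (1 - 8 * i + 4 * j)) / 10, (1 - (3 - 4 * i - 8 * j)) / 10), ?_⟩
      simp only [gaussMap]
      split_ifs <;> simp only [Prod.mk.injEq] <;> omega
    · refine ⟨.inl ((3 + (3 - 4 * i - 8 * j)) / 10, (1 + (1 - 8 * i + 4 * j)) / 10), ?_⟩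
      simp only [gaussMap]
      split_ifs <;> simp only [Prod.mk.injEq] <;> omega
    · refine ⟨.inl ((3 - (3 - 4 * i - 8 * j)) / 10, (1 - (1 - 8 * i + 4 * j)) / 10), ?_⟩
      simp only [gaussMap]
      split_ifs <;> simp only [Prod.mk.injEq] <;> omega
    · refine ⟨.inl ((3 - (1 - 8 * i + 4 * j)) / 10, (1 + (3 - 4 * i - 8 * j)) / 10), ?_⟩
      simp only [gaussMap]
      split_ifs <;> simp only [Prod.mk.injEq] <;> omega

theorem gaussMap_inl (a b : ℤ) :
    2 * (gaussMap (.inl (a, b))).1 ^ 2 - (gaussMap (.inl (a, b))).1 +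
      (2 * (gaussMap (.inl (a, b))).2 ^ 2 - (gaussMap (.inl (a, b))).2) =
    (5 * a ^ 2 - 3 * a) / 2 + (5 * b ^ 2 - b) / 2 := by
  have h1 := two_mul_five_three a
  have h2 := two_mul_five_one b
  refine mul_left_cancel₀ (two_ne_zero (α := ℤ)) ?_
  rw [mul_add 2 (_ / 2), h1, h2]
  simp only [gaussMap]
  rcases Int.even_or_odd' a with ⟨c, rfl | rfl⟩ <;> rcases Int.even_or_odd' b with ⟨d, rfl | rfl⟩
  · rw [if_pos (by omega), if_pos (by omega), show 2 * c / 2 = c by omega,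
      show 2 * d / 2 = d by omega]
    ring
  · rw [if_pos (by omega), if_neg (by omega), show 2 * c / 2 = c by omega,
      show (1 - 2 * (2 * c) + (2 * d + 1)) / 2 = 1 - 2 * c + d by omega]
    ring
  · rw [if_neg (by omega), if_pos (by omega), show 2 * d / 2 = d by omega,
      show (1 - 2 * (2 * d) - (2 * c + 1)) / 2 = - 2 * d - c by omega]
    ring
  · rw [if_neg (by omega), if_neg (by omega),
      show (1 - 2 * (2 * d + 1) - (2 * c + 1)) / 2 = - 2 * d - c - 1 by omega,
      show (1 - 2 * (2 * c + 1) + (2 * d + 1)) / 2 = - 2 * c + d by omega]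
    ring

/-- Ramanujan's identity `ψ(q)² - q ψ(q⁵)² = f(q, q⁴) f(q², q³)`. -/
theorem thetaPsi_sq : thetaPsi ^ 2 =
    (∑' j : ℤ, xp ((5 * j ^ 2 - 3 * j) / 2)) * (∑' j : ℤ, xp ((5 * j ^ 2 - j) / 2)) +
      X * (∑' j : ℤ, xp (5 * (2 * j ^ 2 - j))) ^ 2 := by
  have h1 := abs_le_of_two_mul_eq le_rfl (by norm_num) two_mul_five_three_eq
  have h2 := abs_le_of_two_mul_eq (by norm_num) (by norm_num) two_mul_five_one_eq
  have h10 : ∀ j : ℤ, 0 ≤ (5 * j ^ 2 - 3 * j) / 2 := fun j => (abs_nonneg j).trans (h1 j)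
  have h20 : ∀ j : ℤ, 0 ≤ (5 * j ^ 2 - j) / 2 := fun j => (abs_nonneg j).trans (h2 j)
  have h30 : ∀ j : ℤ, 0 ≤ 5 * (2 * j ^ 2 - j) := fun j =>
    mul_nonneg (by norm_num) (two_one_nonneg j)
  have t1 := tendsto_cofinite_of_abs_le h1
  have t2 := tendsto_cofinite_of_abs_le h2
  have t12 := tendsto_cofinite_add t1 t2 h10 h20
  have t3 := tendsto_cofinite_add tendsto_ten_five tendsto_ten_five h30 h30
  rw [sq, sq, thetaPsi, tsum_xp_mul_tsum_xp tendsto_two_one tendsto_two_one two_one_nonneg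
    two_one_nonneg, tsum_xp_mul_tsum_xp t1 t2 h10 h20,
    tsum_xp_mul_tsum_xp tendsto_ten_five tendsto_ten_five h30 h30,
    ← (summable_xp t3).tsum_mul_left, ← (Equiv.ofBijective _ gaussMap_bijective).tsum_eq]
  simp only [Equiv.ofBijective_apply]
  have e1 : ∀ p : ℤ × ℤ, xp (2 * (gaussMap (.inl p)).1 ^ 2 - (gaussMap (.inl p)).1 +
      (2 * (gaussMap (.inl p)).2 ^ 2 - (gaussMap (.inl p)).2)) =
      xp ((5 * p.1 ^ 2 - 3 * p.1) / 2 + (5 * p.2 ^ 2 - p.2) / 2) := fun ⟨a, b⟩ => by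
    rw [gaussMap_inl]
  -- Here 8E + 2 = 5(8E' + 2), so E = 5E' + 1, whence the factor q.
  have e2 : ∀ p : ℤ × ℤ, xp (2 * (gaussMap (.inr p)).1 ^ 2 - (gaussMap (.inr p)).1 +
      (2 * (gaussMap (.inr p)).2 ^ 2 - (gaussMap (.inr p)).2)) =
      X * xp (5 * (2 * p.1 ^ 2 - p.1) + 5 * (2 * p.2 ^ 2 - p.2)) := fun ⟨i, j⟩ => by
    have hX : (X : ℤ⟦X⟧) = xp 1 := by simp [xp]
    rw [hX, xp_mul zero_le_one (add_nonneg (h30 _) (h30 _))]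
    simp only [gaussMap]
    congr 1; ring
  rw [Summable.tsum_sum]
  · simp only [e1, e2]
  · simp only [Function.comp_def, e1]
    exact summable_xp t12
  · simp only [Function.comp_def, e2]
    exact (summable_xp t3).mul_left _

/-! ### Reduction modulo `2` -/

/-- Reduction of integral power series modulo `2`. -/
noncomputable def red : ℤ⟦X⟧ →+* (ZMod 2)⟦X⟧ := PowerSeries.map (Int.castRingHom (ZMod 2))

theorem coeff_red (n : ℕ) (f : ℤ⟦X⟧) : coeff n (red f) = ((coeff n f : ℤ) : ZMod 2) := by simp [red]

theorem red_X : red X = X := by simp [red]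

theorem two_eq_zero : (2 : (ZMod 2)⟦X⟧) = 0 := by
  rw [← map_ofNat (C (R := ZMod 2)) 2, show (OfNat.ofNat 2 : ZMod 2) = 0 from rfl, map_zero]

theorem sub_eq_add_mod_two (a b : (ZMod 2)⟦X⟧) : a - b = a + b := by
  linear_combination -b * two_eq_zero

theorem continuous_red : Continuous red := by
  refine continuous_iff_continuousAt.2 fun f => ?_
  rw [ContinuousAt, PowerSeries.WithPiTopology.tendsto_iff_coeff_tendsto]
  intro d
  simp only [coeff_red]
  exact ((continuous_of_discreteTopology (f := fun z : ℤ => (z : ZMod 2))).tendsto _).comp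
    ((PowerSeries.WithPiTopology.continuous_coeff ℤ d).tendsto f)

theorem tendsto_red {α : Type*} {l : Filter α} {F : α → ℤ⟦X⟧} {a : ℤ⟦X⟧} (h : Tendsto F l (𝓝 a)) :
    Tendsto (fun x => red (F x)) l (𝓝 (red a)) :=
  (continuous_red.tendsto a).comp h

theorem red_eq_of_tendsto {α : Type*} {l : Filter α} [l.NeBot] {F G : α → ℤ⟦X⟧} {a b : ℤ⟦X⟧}
    (hF : Tendsto F l (𝓝 a)) (hG : Tendsto G l (𝓝 b)) (h : ∀ x, red (F x) = red (G x)) :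
    red a = red b :=
  tendsto_nhds_unique (tendsto_red hF) (by simpa only [h] using tendsto_red hG)

/-- Frobenius is the identity on the coefficient field F_2. -/
theorem sq_eq_expand (f : (ZMod 2)⟦X⟧) : f ^ 2 = expand 2 two_ne_zero f := by
  have h := MvPowerSeries.map_frobenius_expand (R := ZMod 2) 2 two_ne_zero (f := f)
  rw [ZMod.frobenius_zmod, MvPowerSeries.map_id] at h
  exact h.symm

theorem coeff_sq_even (f : (ZMod 2)⟦X⟧) (n : ℕ) : coeff (2 * n) (f ^ 2) = coeff n f := by
  rw [sq_eq_expand, coeff_expand_mul]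

theorem coeff_sq_odd (f : (ZMod 2)⟦X⟧) (n : ℕ) : coeff (2 * n + 1) (f ^ 2) = 0 := by
  rw [sq_eq_expand, coeff_expand_of_not_dvd]
  omega

/-- The reduction of `(q ^ m)_∞` modulo `2`. -/
noncomputable def eu (m : ℕ) : (ZMod 2)⟦X⟧ := red (eulerProd m)

theorem red_eulerProd (m : ℕ) : red (eulerProd m) = eu m := rfl

theorem eu_ne_zero {m : ℕ} (hm : 1 ≤ m) : eu m ≠ 0 := by
  intro h
  have := congrArg (coeff 0) h
  rw [eu, coeff_red, coeff_zero_eq_constantCoeff_apply, constantCoeff_eulerProd hm] at this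
  simp at this

theorem expand_qPoch {k : ℕ} (hk : k ≠ 0) (m n : ℕ) :
    expand k hk (qPoch (X ^ m) (X ^ m) n) = qPoch (X ^ (k * m)) (X ^ (k * m)) n := by
  simp [qPoch, map_prod, pow_mul]

theorem tendsto_expand {α : Type*} {l : Filter α} {k : ℕ} (hk : k ≠ 0) {F : α → ℤ⟦X⟧} {a : ℤ⟦X⟧}
    (h : Tendsto F l (𝓝 a)) : Tendsto (fun x => expand k hk (F x)) l (𝓝 (expand k hk a)) := by
  rw [PowerSeries.WithPiTopology.tendsto_iff_coeff_tendsto] at h ⊢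
  intro d
  simp only [coeff_expand]
  split_ifs
  · exact h _
  · exact tendsto_const_nhds

theorem expand_eulerProd {k m : ℕ} (hk : k ≠ 0) (hm : 1 ≤ m) :
    expand k hk (eulerProd m) = eulerProd (k * m) := by
  refine tendsto_nhds_unique (tendsto_expand hk (tendsto_qPoch hm)) ?_
  simp only [expand_qPoch]
  exact tendsto_qPoch (Nat.mul_pos (Nat.pos_of_ne_zero hk) hm)

theorem expand_eu {k m : ℕ} (hk : k ≠ 0) (hm : 1 ≤ m) : expand k hk (eu m) = eu (k * m) := by
  rw [eu, eu, ← expand_eulerProd hk hm, red, map_expand]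

theorem eu_two_mul {m : ℕ} (hm : 1 ≤ m) : eu (2 * m) = eu m ^ 2 := by
  rw [sq_eq_expand, expand_eu two_ne_zero hm]

theorem red_one_add_X_pow (n : ℕ) : red (1 + X ^ n) = 1 - X ^ n := by
  rw [map_add, map_pow, red_X, map_one, sub_eq_add_mod_two]

theorem red_one_sub_X_pow (n : ℕ) : red (1 - X ^ n) = 1 - X ^ n := by
  rw [map_sub, map_pow, red_X, map_one]

theorem tendsto_qPoch_mul {c : ℕ} (hc : 1 ≤ c) {k : ℕ} (hk : 1 ≤ k) :
    Tendsto (fun N => qPoch (X ^ c) (X ^ c) (k * N)) atTop (𝓝 (eulerProd c)) :=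
  (tendsto_qPoch hc).comp (tendsto_id.const_mul_atTop' hk)

theorem red_qPoch_succ (c n : ℕ) : red (qPoch (X ^ c) (X ^ c) (n + 1)) =
    red (qPoch (X ^ c) (X ^ c) n) * (1 - X ^ (c * (n + 1))) := by
  rw [qPoch_succ, map_mul, red_one_sub_X_pow]

theorem red_prod_succ (a c n : ℕ) : red (∏ k ∈ Finset.range (n + 1), (1 + X ^ (a + c * k))) =
    red (∏ k ∈ Finset.range n, (1 + X ^ (a + c * k))) * (1 - X ^ (a + c * n)) := by
  rw [Finset.prod_range_succ, map_mul, red_one_add_X_pow]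

/-- Modulo 2 the triple product is (odd-exponent factors)·E_4. Multiplying by E_2 completes the odd
factors to E_1, so ψ E_2 = E_1 E_4, and E_2 = E_1^2, E_4 = E_1^4. The matching is done on partial
products, where it is exact. -/
theorem red_thetaPsi : red thetaPsi = eu 1 ^ 3 := by
  have h1 := tendsto_triple_product (a := 1) (b := 3) (e := fun j => 2 * j ^ 2 - j) le_rfl
    (by norm_num) (fun j => by push_cast; ring)
  simp only [Nat.reduceAdd] at h1
  have h2 := h1.mul (tendsto_qPoch_mul (c := 2) (by norm_num) (k := 2) (by norm_num))
  have h3 := (tendsto_qPoch_mul (c := 1) le_rfl (k := 4) (by norm_num)).mul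
    (tendsto_qPoch (c := 4) (by norm_num))
  have h4 := red_eq_of_tendsto h2 h3 fun N => by
    rw [map_mul, map_mul, map_mul, map_mul, mul_right_comm]
    congr 1
    induction N with
    | zero => simp [qPoch]
    | succ N ih =>
      rw [red_prod_succ, red_prod_succ, show 2 * (N + 1) = 2 * N + 1 + 1 by ring,
        show 4 * (N + 1) = 4 * N + 1 + 1 + 1 + 1 by ring]
      simp only [red_qPoch_succ]
      rw [← ih]
      ring
  rw [map_mul, map_mul] at h4
  simp only [red_eulerProd] at h4
  have h5 := eu_two_mul (m := 1) le_rfl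
  have h6 := eu_two_mul (m := 2) (by norm_num)
  simp only [Nat.reduceMul] at h5 h6
  refine mul_right_cancel₀ (eu_ne_zero (m := 2) (by norm_num)) ?_
  rw [thetaPsi, h4, h6, h5]
  ring

/-- The residues 1, 4, 2, 3 modulo 5 from the two triple products, with one copy of E_5, fill out
E_1; the other E_5 remains. -/
theorem red_theta_mul_theta : red (∑' j : ℤ, xp ((5 * j ^ 2 - 3 * j) / 2)) *
    red (∑' j : ℤ, xp ((5 * j ^ 2 - j) / 2)) = eu 1 * eu 5 := by
  have h1 := (tendsto_triple_product (a := 1) (b := 4) le_rfl (by norm_num)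
    two_mul_five_three_eq).mul (tendsto_triple_product (a := 2) (b := 3) (by norm_num)
    (by norm_num) two_mul_five_one_eq)
  have h2 := (tendsto_qPoch_mul (c := 1) le_rfl (k := 5) (by norm_num)).mul
    (tendsto_qPoch (c := 5) (by norm_num))
  have h3 := red_eq_of_tendsto h1 h2 fun N => by
    simp only [map_mul]
    rw [← mul_assoc]
    congr 1
    induction N with
    | zero => simp [qPoch]
    | succ N ih =>
      rw [red_prod_succ, red_prod_succ, red_prod_succ, red_prod_succ,
        show 5 * (N + 1) = 5 * N + 1 + 1 + 1 + 1 + 1 by ring]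
      simp only [red_qPoch_succ]
      rw [← ih]
      ring
  rw [map_mul, map_mul] at h3
  exact h3

theorem tendsto_three_one : Tendsto (fun j : ℤ => 3 * j ^ 2 - j) cofinite atTop := by
  simpa [← sub_eq_add_neg] using
    tendsto_quadratic (a := 3) (b := -1) (c := 0) (by norm_num) le_rfl

theorem red_tsum_pentagonal : red (∑' j : ℤ, xp (3 * j ^ 2 - j)) = eu 2 := by
  have h1 := tendsto_triple_product (a := 2) (b := 4) (e := fun j => 3 * j ^ 2 - j) (by norm_num)
    (by norm_num) (fun j => by push_cast; ring)
  refine red_eq_of_tendsto h1 (tendsto_qPoch_mul (c := 2) (by norm_num) (k := 3) (by norm_num))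
    fun N => ?_
  simp only [map_mul]
  induction N with
  | zero => simp [qPoch]
  | succ N ih =>
    rw [red_prod_succ, red_prod_succ, show 3 * (N + 1) = 3 * N + 1 + 1 + 1 by ring]
    simp only [red_qPoch_succ]
    rw [← ih]
    ring

theorem expand_tsum_xp {k : ℕ} (hk : k ≠ 0) {ι : Type*} {f : ι → ℤ}
    (hf : Tendsto f cofinite atTop) (hf0 : ∀ i, 0 ≤ f i) :
    expand k hk (∑' i, xp (f i)) = ∑' i, xp (k * f i) := by
  have hc : Continuous (expand k hk (R := ℤ)) :=
    continuous_iff_continuousAt.2 fun f => tendsto_expand hk tendsto_id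
  rw [(summable_xp hf).map_tsum _ hc]
  refine tsum_congr fun i => ?_
  obtain ⟨n, hn⟩ := Int.eq_ofNat_of_zero_le (hf0 i)
  rw [hn, xp_natCast, map_pow, expand_X, ← pow_mul, ← xp_natCast]
  push_cast; rfl

/-- The modular equation of degree five for `(q)_∞` modulo `2`. -/
theorem eu_one_mul_eu_five : eu 1 * eu 5 = eu 1 ^ 6 + X * eu 5 ^ 6 := by
  have h1 := congrArg red thetaPsi_sq
  have h2 : red (∑' j : ℤ, xp (5 * (2 * j ^ 2 - j))) = eu 5 ^ 3 := by
    have := expand_tsum_xp (k := 5) (by norm_num) tendsto_two_one two_one_nonneg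
    rw [← thetaPsi] at this
    push_cast at this
    rw [← this, red, map_expand, ← red, red_thetaPsi, map_pow, expand_eu (by norm_num) le_rfl]
  rw [map_add, map_mul, map_mul, map_pow, map_pow, red_thetaPsi, h2, red_theta_mul_theta,
    red_X] at h1
  linear_combination -h1 - X * eu 5 ^ 6 * two_eq_zero

/-! ### Dissections modulo `2` -/

/-- The reduction of `1 / (q ^ m)_∞` modulo `2`. -/
noncomputable def euInv (m : ℕ) : (ZMod 2)⟦X⟧ := red (inv1 (eulerProd m))

theorem eu_mul_euInv {m : ℕ} (hm : 1 ≤ m) : eu m * euInv m = 1 := by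
  rw [eu, euInv, ← map_mul, mul_inv1 (constantCoeff_eulerProd hm), map_one]

/-- The reduction modulo `2` of `(q)_∞ ^ 2 / (q ^ 5)_∞`. -/
noncomputable def euQuot : (ZMod 2)⟦X⟧ := eu 1 ^ 2 * euInv 5

theorem euQuot_mul_eu_five : euQuot * eu 5 = eu 1 ^ 2 := by
  rw [euQuot]
  linear_combination eu 1 ^ 2 * eu_mul_euInv (m := 5) (by norm_num)

/-- The dissection modulo four of `(q)_∞ ^ 3 / (q ^ 5)_∞ ^ 3`. -/
noncomputable def cubeQuot : (ZMod 2)⟦X⟧ :=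
  euQuot ^ 4 + X * (eu 1 ^ 3) ^ 4 + X ^ 3 * (eu 5 ^ 3) ^ 4

/-- With A = E_1, B = E_5: A^2 times the modular equation gives A^3 B = A^8 + q A^2 B^6, and its
square times q B^4 expands the last term as q A^12 B^4 + q^3 B^16. Dividing by B^4 gives the
dissection. -/
theorem cubeQuot_mul : cubeQuot * eu 5 ^ 3 = eu 1 ^ 3 := by
  refine mul_right_cancel₀ (eu_ne_zero (m := 5) (by norm_num)) ?_
  have h1 : euQuot ^ 4 * eu 5 ^ 4 = eu 1 ^ 8 := by rw [← mul_pow, euQuot_mul_eu_five]; ring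
  rw [cubeQuot]
  linear_combination h1 - (eu 1 ^ 2 + X * eu 5 ^ 4 * (eu 1 * eu 5 + eu 1 ^ 6 + X * eu 5 ^ 6)) *
    eu_one_mul_eu_five - X ^ 2 * eu 1 ^ 6 * eu 5 ^ 10 * two_eq_zero

theorem pow_four_eq_expand (f : (ZMod 2)⟦X⟧) : f ^ 4 = expand 4 four_ne_zero f := by
  rw [show f ^ 4 = (f ^ 2) ^ 2 by ring, sq_eq_expand, sq_eq_expand]
  exact (expand_mul 2 two_ne_zero 2 two_ne_zero f).symm

theorem coeff_cubeQuot (n : ℕ) :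
    coeff (4 * n) cubeQuot = coeff n euQuot ∧ coeff (4 * n + 1) cubeQuot = coeff n (eu 1 ^ 3) ∧
      coeff (4 * n + 2) cubeQuot = 0 ∧ coeff (4 * n + 3) cubeQuot = coeff n (eu 5 ^ 3) := by
  have h : ∀ m, coeff m cubeQuot = (if 4 ∣ m then coeff (m / 4) euQuot else 0) +
      (if 1 ≤ m then if 4 ∣ m - 1 then coeff ((m - 1) / 4) (eu 1 ^ 3) else 0 else 0) +
      if 3 ≤ m then if 4 ∣ m - 3 then coeff ((m - 3) / 4) (eu 5 ^ 3) else 0 else 0 := by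
    intro m
    rw [cubeQuot, pow_four_eq_expand, pow_four_eq_expand (eu 1 ^ 3), pow_four_eq_expand (eu 5 ^ 3),
      map_add, map_add, coeff_expand, coeff_X_pow_mul', coeff_expand]
    nth_rewrite 1 [← pow_one (X : (ZMod 2)⟦X⟧)]
    rw [coeff_X_pow_mul', coeff_expand]
  have h0 : 4 * n / 4 = n := by omega
  have h1 : (4 * n + 1 - 1) / 4 = n := by omega
  have h3 : (4 * n + 3 - 3) / 4 = n := by omega
  refine ⟨?_, ?_, ?_, ?_⟩ <;> rw [h] <;> split_ifs <;>
    first | omega | simp only [h0, h1, h3, add_zero, zero_add]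

/-! ### The five-dissection -/

/-- A splitting of the integers into residue classes modulo `5`. -/
def fiveMap : (ℤ ⊕ ℤ) ⊕ ((ℤ ⊕ ℤ) ⊕ ℤ) → ℤ
  | .inl (.inl m) => -5 * m
  | .inl (.inr m) => 5 * m + 2
  | .inr (.inl (.inl m)) => -5 * m - 1
  | .inr (.inl (.inr m)) => -5 * m - 2
  | .inr (.inr m) => -5 * m + 1

theorem fiveMap_bijective : Function.Bijective fiveMap := by
  constructor
  · rintro ((a | a) | ((a | a) | a)) ((b | b) | ((b | b) | b)) h <;> simp only [fiveMap] at h <;>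
      first
      | omega
      | (obtain rfl : a = b := by omega
         rfl)
  · intro j
    have h : j % 5 = 0 ∨ j % 5 = 1 ∨ j % 5 = 2 ∨ j % 5 = 3 ∨ j % 5 = 4 := by omega
    rcases h with h | h | h | h | h
    · exact ⟨.inl (.inl (-(j / 5))), by simp only [fiveMap]; omega⟩
    · exact ⟨.inr (.inr (-(j / 5))), by simp only [fiveMap]; omega⟩
    · exact ⟨.inl (.inr (j / 5)), by simp only [fiveMap]; omega⟩
    · exact ⟨.inr (.inl (.inr (-(j / 5) - 1))), by simp only [fiveMap]; omega⟩
    · exact ⟨.inr (.inl (.inl (-(j / 5) - 1))), by simp only [fiveMap]; omega⟩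

theorem X_pow_mul_expand_tsum_xp {k : ℕ} (hk : k ≠ 0) (r : ℕ) {f : ℤ → ℤ}
    (hf : ∀ j, |j| ≤ f j) : X ^ r * expand k hk (∑' j, xp (f j)) = ∑' j, xp (r + k * f j) := by
  have hf0 : ∀ j, 0 ≤ f j := fun j => (abs_nonneg j).trans (hf j)
  have hk1 : (1 : ℤ) ≤ k := by exact_mod_cast Nat.pos_of_ne_zero hk
  have h1 : Tendsto (fun j => k * f j) cofinite atTop :=
    tendsto_cofinite_of_abs_le fun j => (hf j).trans (by nlinarith [hf0 j])
  rw [expand_tsum_xp hk (tendsto_cofinite_of_abs_le hf) hf0, ← (summable_xp h1).tsum_mul_left]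
  refine tsum_congr fun j => ?_
  rw [← xp_natCast, xp_mul (by positivity) (mul_nonneg (by positivity) (hf0 j))]

theorem abs_le_three_one (j : ℤ) : |j| ≤ 3 * j ^ 2 - j := by
  simpa [← sub_eq_add_neg] using
    abs_le_quadratic (a := 3) (b := -1) (c := 0) (by norm_num) le_rfl j

theorem abs_le_fifteen_one (j : ℤ) : |j| ≤ 15 * j ^ 2 + j := by
  simpa using abs_le_quadratic (a := 15) (b := 1) (c := 0) (by norm_num) le_rfl j

theorem abs_le_fifteen_seven (j : ℤ) : |j| ≤ 15 * j ^ 2 + 7 * j := by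
  simpa using abs_le_quadratic (a := 15) (b := 7) (c := 0) (by norm_num) le_rfl j

theorem abs_le_fifteen_eleven (j : ℤ) : |j| ≤ 15 * j ^ 2 + 11 * j + 2 :=
  abs_le_quadratic (a := 15) (b := 11) (c := 2) (by norm_num) (by norm_num) j

theorem abs_le_fifteen_thirteen (j : ℤ) : |j| ≤ 15 * j ^ 2 + 13 * j + 2 :=
  abs_le_quadratic (a := 15) (b := 13) (c := 2) (by norm_num) (by norm_num) j

/-- The theta series in the class `0` modulo `5` of the pentagonal series. -/
noncomputable def thetaZero : ℤ⟦X⟧ :=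
  ∑' m : ℤ, xp (15 * m ^ 2 + m) + ∑' m : ℤ, xp (15 * m ^ 2 + 11 * m + 2)

/-- The theta series in the class `4` modulo `5` of the pentagonal series. -/
noncomputable def thetaFour : ℤ⟦X⟧ :=
  ∑' m : ℤ, xp (15 * m ^ 2 + 7 * m) + ∑' m : ℤ, xp (15 * m ^ 2 + 13 * m + 2)

/-- Modulo 5, 3j^2 - j is 0 for j ≡ 0, 2; it is 4 for j ≡ 3, 4; and it is 2 for j ≡ 1, where j =
1-5m gives 25(3m^2-m) + 2. -/
theorem tsum_pentagonal_dissection : ∑' j : ℤ, xp (3 * j ^ 2 - j) =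
    expand 5 (by norm_num) thetaZero + X ^ 4 * expand 5 (by norm_num) thetaFour +
      X ^ 2 * expand 25 (by norm_num) (∑' j : ℤ, xp (3 * j ^ 2 - j)) := by
  have h5 : (5 : ℕ) ≠ 0 := by norm_num
  have e0 := X_pow_mul_expand_tsum_xp h5 0 abs_le_fifteen_one
  have e1 := X_pow_mul_expand_tsum_xp h5 0 abs_le_fifteen_eleven
  have e2 := X_pow_mul_expand_tsum_xp h5 4 abs_le_fifteen_seven
  have e3 := X_pow_mul_expand_tsum_xp h5 4 abs_le_fifteen_thirteen
  have e4 := X_pow_mul_expand_tsum_xp (k := 25) (by norm_num) 2 abs_le_three_one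
  rw [pow_zero, one_mul] at e0 e1
  rw [thetaZero, thetaFour, map_add, map_add, mul_add, e0, e1, e2, e3, e4]
  have hs := (summable_xp tendsto_three_one).comp_injective fiveMap_bijective.1
  have hl := hs.comp_injective Sum.inl_injective
  have hr := hs.comp_injective Sum.inr_injective
  have hrl := hr.comp_injective Sum.inl_injective
  have h := (Equiv.ofBijective _ fiveMap_bijective).tsum_eq fun j : ℤ => xp (3 * j ^ 2 - j)
  rw [← h]
  refine ((Summable.tsum_sum hl hr).trans (congrArg₂ (· + ·)
    (Summable.tsum_sum (hl.comp_injective Sum.inl_injective) (hl.comp_injective Sum.inr_injective))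
    ((Summable.tsum_sum hrl (hr.comp_injective Sum.inr_injective)).trans (congrArg₂ (· + ·)
      (Summable.tsum_sum (hrl.comp_injective Sum.inl_injective)
        (hrl.comp_injective Sum.inr_injective)) rfl)))).trans ?_
  rw [add_assoc (_ + _)]
  simp only [Function.comp, fiveMap]
  push_cast
  congr 1
  · congr 1 <;> refine tsum_congr fun m => ?_ <;> congr 1 <;> ring
  · congr 1
    · congr 1 <;> refine tsum_congr fun m => ?_ <;> congr 1 <;> ring
    · refine tsum_congr fun m => ?_
      congr 1; ring

/-- E_1^2 = E_2 is the pentagonal series, and the divisor E_5 is a series in q^5, so it respects the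
classes. -/
theorem euQuot_dissection : euQuot =
    expand 5 (by norm_num) (red thetaZero * euInv 1) +
      X ^ 4 * expand 5 (by norm_num) (red thetaFour * euInv 1) +
        X ^ 2 * expand 5 (by norm_num) (eu 10 * euInv 1) := by
  refine mul_right_cancel₀ (eu_ne_zero (m := 5) (by norm_num)) ?_
  have h1 := congrArg red tsum_pentagonal_dissection
  have h2 := expand_eu (k := 5) (m := 1) (by norm_num) le_rfl
  have h3 : expand 5 (by norm_num) (eu 1) * expand 5 (by norm_num) (euInv 1) = 1 := by
    rw [← map_mul, eu_mul_euInv le_rfl, map_one]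
  have h4 : red (expand 25 (by norm_num) (∑' j : ℤ, xp (3 * j ^ 2 - j))) =
      expand 5 (by norm_num) (eu 10) := by
    have a := expand_eu (k := 25) (m := 2) (by norm_num) (by norm_num)
    have b := expand_eu (k := 5) (m := 10) (by norm_num) (by norm_num)
    simp only [Nat.reduceMul] at a b
    rw [red, map_expand, ← red, red_tsum_pentagonal, a, b]
  have h5 : ∀ f : ℤ⟦X⟧, red (expand 5 (by norm_num) f) = expand 5 (by norm_num) (red f) :=
    fun f => map_expand _ _ _ _
  have h6 := eu_two_mul (m := 1) le_rfl
  simp only [Nat.reduceMul] at h2 h6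
  simp only [map_add, map_mul, map_pow, red_X, h4, h5, red_tsum_pentagonal] at h1
  rw [euQuot_mul_eu_five, ← h6, h1, ← h2]
  simp only [map_mul]
  linear_combination -(expand 5 (by norm_num) (red thetaZero) +
    X ^ 4 * expand 5 (by norm_num) (red thetaFour) +
      X ^ 2 * expand 5 (by norm_num) (eu 10)) * h3

theorem coeff_euQuot (n : ℕ) :
    coeff (5 * n) euQuot = coeff n (red thetaZero * euInv 1) ∧ coeff (5 * n + 1) euQuot = 0 ∧
      coeff (5 * n + 2) euQuot = coeff n (eu 10 * euInv 1) ∧ coeff (5 * n + 3) euQuot = 0 ∧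
        coeff (5 * n + 4) euQuot = coeff n (red thetaFour * euInv 1) := by
  have h : ∀ m, coeff m euQuot =
      (if 5 ∣ m then coeff (m / 5) (red thetaZero * euInv 1) else 0) +
      (if 4 ≤ m then if 5 ∣ m - 4 then coeff ((m - 4) / 5) (red thetaFour * euInv 1) else 0
        else 0) +
      if 2 ≤ m then if 5 ∣ m - 2 then coeff ((m - 2) / 5) (eu 10 * euInv 1) else 0 else 0 := by
    intro m
    rw [euQuot_dissection, map_add, map_add, coeff_expand, coeff_X_pow_mul', coeff_X_pow_mul',
      coeff_expand, coeff_expand]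
  have h0 : 5 * n / 5 = n := by omega
  have h2 : (5 * n + 2 - 2) / 5 = n := by omega
  have h4 : (5 * n + 4 - 4) / 5 = n := by omega
  refine ⟨?_, ?_, ?_, ?_, ?_⟩ <;> rw [h] <;> split_ifs <;>
    first | omega | simp only [h0, h2, h4, add_zero, zero_add]

/-! ### The mock theta functions and restricted partitions modulo `2` -/

theorem red_inv1_eq {f g : ℤ⟦X⟧} (hf : constantCoeff f = 1) (hg : constantCoeff g = 1)
    (h : red f = red g) : red (inv1 f) = red (inv1 g) := by
  have h1 := congrArg red (mul_inv1 hf)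
  have h2 := congrArg red (mul_inv1 hg)
  rw [map_mul, map_one] at h1 h2
  rw [h] at h1
  linear_combination red (inv1 g) * h1 - red (inv1 f) * h2

theorem red_neg (f : ℤ⟦X⟧) : red (-f) = red f := by
  rw [map_neg]
  linear_combination -red f * two_eq_zero

theorem red_inv1_qPoch_neg (n : ℕ) : red (inv1 (qPoch (-X) X n)) = red (iq 1 n) := by
  rw [iq_natCast, pow_one]
  refine red_inv1_eq (constantCoeff_qPoch n) (by simpa using constantCoeff_qPoch_X le_rfl n) ?_
  simp only [qPoch, map_prod, map_sub, map_mul, map_pow, map_one, red_neg]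

theorem red_neg_one_pow (n : ℕ) : red ((-1) ^ n) = 1 := by
  rw [map_pow, red_neg, map_one, one_pow]

theorem red_mockX10 : red mockX10 = red thetaZero * euInv 1 := by
  have hf : Tendsto (fun n : ℕ => (n : ℤ) ^ 2) cofinite atTop :=
    tendsto_cofinite_of_natCast_le fun n => by exact_mod_cast Nat.le_self_pow two_ne_zero n
  have h1 : red mockX10 = red (∑' n : ℕ, xp (n ^ 2) * iq 1 (2 * n : ℕ)) := by
    rw [mockX10, summable_mockX10.map_tsum red continuous_red,
      (summable_xp_mul hf _).map_tsum red continuous_red]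
    refine tsum_congr fun n => ?_
    rw [map_mul, map_mul, red_neg_one_pow, one_mul, red_inv1_qPoch_neg, map_mul, ← xp_natCast]
    push_cast; rfl
  rw [h1, tsum_sq_iq_even, thetaZero, map_mul, map_sub, map_add, sub_eq_add_mod_two]
  rfl

theorem red_mockChi10 : red mockChi10 = X * (red thetaFour * euInv 1) := by
  have hf : Tendsto (fun n : ℕ => (n : ℤ) ^ 2 + 2 * n) cofinite atTop :=
    tendsto_cofinite_of_natCast_le fun n => by nlinarith
  have h1 : red mockChi10 = red (X * ∑' n : ℕ, xp (n ^ 2 + 2 * n) * iq 1 (2 * n + 1 : ℕ)) := by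
    rw [mockChi10, summable_mockChi10.map_tsum red continuous_red, ← tsum_mul_xp_mul_left hf,
      ((summable_xp_mul hf _).mul_left _).map_tsum red continuous_red]
    refine tsum_congr fun n => ?_
    have h2 : (X : ℤ⟦X⟧) ^ ((n + 1) ^ 2) = X * xp (n ^ 2 + 2 * n) := by
      rw [show (n : ℤ) ^ 2 + 2 * n = (n ^ 2 + 2 * n : ℕ) by push_cast; ring, xp_natCast]
      ring
    rw [map_mul, map_mul, red_neg_one_pow, one_mul, red_inv1_qPoch_neg, h2, ← map_mul, mul_assoc]
  rw [h1, tsum_sq_iq_odd, thetaFour, map_mul, map_mul, map_sub, map_add, sub_eq_add_mod_two, red_X]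
  rfl

theorem eulerProd_eq_tprod (m : ℕ) : eulerProd m = ∏' i : ℕ, (1 - X ^ ((i + 1) * m)) := by
  rw [eulerProd]
  congr 1
  funext k
  ring

/-- By Glaisher's theorem one may count partitions with no part repeated 10 or more times; each
geometric factor times 1 - q^i telescopes to 1 - q^(10i). -/
theorem mk_p10_mul_eulerProd_one :
    PowerSeries.mk (fun n => (p10 n : ℤ)) * eulerProd 1 = eulerProd 10 := by
  have h1 : PowerSeries.mk (fun n => (p10 n : ℤ)) =
      PowerSeries.mk fun n => ((Nat.Partition.restricted n (¬ 10 ∣ ·)).card : ℤ) := rfl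
  rw [h1, Nat.Partition.powerSeriesMk_card_restricted_eq_powerSeriesMk_card_countRestricted
    (R := ℤ) (by norm_num), Nat.Partition.powerSeriesMk_card_countRestricted_eq_tprod ℤ
    (by norm_num), eulerProd_eq_tprod, eulerProd_eq_tprod]
  simp only [mul_one]
  rw [← (Nat.Partition.multipliable_powerSeriesMk_card_countRestricted ℤ 10).tprod_mul
    (PowerSeries.WithPiTopology.multipliable_one_sub_X_pow ℤ)]
  exact tprod_congr fun i => by simp_rw [pow_mul, geom_sum_mul_neg]

theorem red_mk_p10 : red (PowerSeries.mk fun n => (p10 n : ℤ)) = eu 10 * euInv 1 := by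
  have h1 := congrArg red mk_p10_mul_eulerProd_one
  rw [map_mul, red_eulerProd, red_eulerProd] at h1
  rw [← h1]
  linear_combination -red (PowerSeries.mk fun n => (p10 n : ℤ)) * eu_mul_euInv le_rfl

theorem coeff_thetaPsi_eq_one_iff (n : ℕ) :
    coeff n (red thetaPsi) = 1 ↔ ∃ k : ℕ, n = k * (k + 1) / 2 := by
  have hc : HasSum (fun j : ℤ => coeff n (xp (2 * j ^ 2 - j))) (coeff n thetaPsi) :=
    (PowerSeries.WithPiTopology.hasSum_iff_hasSum_coeff _).1
      (summable_xp tendsto_two_one).hasSum n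
  have hx : ∀ j : ℤ, coeff n (xp (2 * j ^ 2 - j)) = if 2 * j ^ 2 - j = n then 1 else 0 := by
    intro j
    rw [xp, coeff_X_pow]
    have := two_one_nonneg j
    congr 1
    exact propext (by omega)
  -- The index k = 2m corresponds to j = -m, and k = 2m+1 to j = m+1.
  have htri : (∃ k : ℕ, n = k * (k + 1) / 2) ↔ ∃ j : ℤ, 2 * j ^ 2 - j = n := by
    constructor
    · rintro ⟨k, rfl⟩
      rcases Nat.even_or_odd' k with ⟨m, rfl | rfl⟩
      · refine ⟨-m, ?_⟩
        rw [show 2 * m * (2 * m + 1) = 2 * (m * (2 * m + 1)) by ring,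
          Nat.mul_div_cancel_left _ (by norm_num)]
        push_cast; ring
      · refine ⟨m + 1, ?_⟩
        rw [show (2 * m + 1) * (2 * m + 1 + 1) = 2 * ((2 * m + 1) * (m + 1)) by ring,
          Nat.mul_div_cancel_left _ (by norm_num)]
        push_cast; ring
    · rintro ⟨j, hj⟩
      rcases lt_or_ge 0 j with h | h
      · obtain ⟨m, rfl⟩ : ∃ m : ℕ, j = m + 1 := ⟨(j - 1).toNat, by omega⟩
        refine ⟨2 * m + 1, ?_⟩
        rw [show (2 * m + 1) * (2 * m + 1 + 1) = 2 * ((2 * m + 1) * (m + 1)) by ring,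
          Nat.mul_div_cancel_left _ (by norm_num)]
        zify; rw [← hj]; ring
      · obtain ⟨m, rfl⟩ : ∃ m : ℕ, j = -m := ⟨(-j).toNat, by omega⟩
        refine ⟨2 * m, ?_⟩
        rw [show 2 * m * (2 * m + 1) = 2 * (m * (2 * m + 1)) by ring,
          Nat.mul_div_cancel_left _ (by norm_num)]
        zify; rw [← hj]; ring
  rw [coeff_red, htri]
  simp only [hx] at hc
  by_cases h : ∃ j : ℤ, 2 * j ^ 2 - j = n
  · refine iff_of_true ?_ h
    obtain ⟨j, hj⟩ := h
    have h1 := hasSum_single (f := fun j : ℤ => if 2 * j ^ 2 - j = n then (1 : ℤ) else 0) j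
      fun i hi => if_neg fun h2 => hi ?_
    · rw [hc.unique h1, if_pos hj, Int.cast_one]
    -- The second factor is odd, so j is unique and the coefficient is exactly 1.
    · have h3 : (i - j) * (2 * (i + j) - 1) = 0 := by linear_combination h2 - hj
      rcases mul_eq_zero.1 h3 with h4 | h4 <;> omega
  · have h1 : ∀ j : ℤ, (if 2 * j ^ 2 - j = n then (1 : ℤ) else 0) = 0 := fun j =>
      if_neg fun h2 => h ⟨j, h2⟩
    simp only [h1] at hc
    rw [hc.unique hasSum_zero, Int.cast_zero]
    exact iff_of_false zero_ne_one h

/-! ### The coefficients of the hauptmoduln -/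

theorem coeff_single_mul (f : ℤ⟦X⟧) (k : ℕ) :
    (HahnSeries.single (-1 : ℤ) (1 : ℤ) * HahnSeries.ofPowerSeries ℤ ℤ f).coeff ((k : ℤ) - 1) =
      coeff k f := by
  rw [sub_eq_add_neg, HahnSeries.coeff_single_mul_add, one_mul,
    HahnSeries.ofPowerSeries_apply_coeff]

theorem red_j5 : red (eulerProd 1 ^ 6 * inv1 (eulerProd 5 ^ 6)) = cubeQuot ^ 2 := by
  refine mul_right_cancel₀ (pow_ne_zero 6 (eu_ne_zero (m := 5) (by norm_num))) ?_
  have h1 : constantCoeff (eulerProd 5 ^ 6) = 1 := by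
    rw [map_pow, constantCoeff_eulerProd (by norm_num), one_pow]
  have h2 := congrArg red (mul_inv1 h1)
  rw [map_mul, map_pow, red_eulerProd, map_one] at h2
  rw [map_mul, map_pow, red_eulerProd]
  linear_combination eu 1 ^ 6 * h2 - (cubeQuot * eu 5 ^ 3 + eu 1 ^ 3) * cubeQuot_mul

/-- The left side reduces to E_1/E_5^5, and the modular equation divided by E_5^6 equates this with
E_1^6/E_5^6 + q. -/
theorem red_j10 : red (eulerProd 2 * eulerProd 5 ^ 5 * inv1 (eulerProd 1 * eulerProd 10 ^ 5)) =
    cubeQuot ^ 2 + X := by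
  refine mul_right_cancel₀ (mul_ne_zero (eu_ne_zero (m := 1) le_rfl)
    (pow_ne_zero 10 (eu_ne_zero (m := 5) (by norm_num)))) ?_
  have h1 : constantCoeff (eulerProd 1 * eulerProd 10 ^ 5) = 1 := by
    rw [map_mul, map_pow, constantCoeff_eulerProd (by norm_num),
      constantCoeff_eulerProd (by norm_num), one_pow, one_mul]
  have h2 := congrArg red (mul_inv1 h1)
  have h3 := eu_two_mul (m := 1) le_rfl
  have h4 := eu_two_mul (m := 5) (by norm_num)
  simp only [Nat.reduceMul] at h3 h4
  rw [map_mul, map_mul, map_pow, red_eulerProd, red_eulerProd, map_one, h4] at h2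
  rw [map_mul, map_mul, map_pow, red_eulerProd, red_eulerProd, h3]
  linear_combination eu 1 ^ 2 * eu 5 ^ 5 * h2 -
    eu 1 * eu 5 ^ 4 * (cubeQuot * eu 5 ^ 3 + eu 1 ^ 3) * cubeQuot_mul +
    eu 1 * eu 5 ^ 4 * eu_one_mul_eu_five

theorem c5_cast (k : ℕ) : ((c5 ((k : ℤ) - 1) : ℤ) : ZMod 2) = coeff k (cubeQuot ^ 2) := by
  rw [c5, j5, coeff_single_mul, ← coeff_red, red_j5]

theorem c10_cast (k : ℕ) : ((c10 ((k : ℤ) - 1) : ℤ) : ZMod 2) = coeff k (cubeQuot ^ 2 + X) := by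
  rw [c10, j10, coeff_single_mul, ← coeff_red, red_j10]

theorem c5_cast_odd {n : ℤ} {k : ℕ} (h : n = 2 * k - 1) :
    ((c5 n : ℤ) : ZMod 2) = coeff k cubeQuot := by
  rw [h, ← coeff_sq_even, ← c5_cast]
  push_cast; rfl

theorem c5_of_lt {n : ℤ} (h : n < -1) : c5 n = 0 := by
  rw [c5, j5, show n = (n + 1) + (-1) by ring, HahnSeries.coeff_single_mul_add, one_mul]
  have := PowerSeries.coeff_coe (eulerProd 1 ^ 6 * inv1 (eulerProd 5 ^ 6)) (n + 1)
  rw [if_pos (by omega)] at this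
  exact this

theorem modEq_two_iff (a b : ℤ) : a ≡ b [ZMOD 2] ↔ (a : ZMod 2) = b :=
  (ZMod.intCast_eq_intCast_iff a b 2).symm

end HauptMock

/-! ### Reading off the congruences -/

theorem theorem1p3 :
    (∀ n : ℕ, 1 ≤ n → HauptMock.c5 n ≡ HauptMock.c10 n [ZMOD 2]) ∧
    -- (1)
    (∀ n : ℕ,
      HauptMock.c5 (2 * n) ≡ 0 [ZMOD 2] ∧
      HauptMock.c5 (8 * n + 3) ≡ 0 [ZMOD 2] ∧
      (∀ i ∈ ({1, 2, 3, 4} : Set ℕ), HauptMock.c5 (40 * n + 5 + 8 * i) ≡ 0 [ZMOD 2]) ∧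
      (∀ j ∈ ({0, 2} : Set ℕ), HauptMock.c5 (40 * n + 7 + 8 * j) ≡ 0 [ZMOD 2])) ∧
    -- (2)
    (∀ n : ℕ, HauptMock.c5 (40 * n - 1) ≡ HauptMock.cX10 n [ZMOD 2]) ∧
    -- (3)
    (∀ n : ℕ, HauptMock.c5 (40 * n - 9) ≡ HauptMock.cChi10 n [ZMOD 2]) ∧
    -- (4)
    (∀ n : ℕ,
      HauptMock.c5 (8 * n + 1) ≡ HauptMock.c5 (40 * n + 5) [ZMOD 2] ∧
      (HauptMock.c5 (8 * n + 1) ≡ 1 [ZMOD 2] ↔ ∃ k : ℕ, n = k * (k + 1) / 2)) ∧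
    -- (5)
    (∀ n : ℕ, HauptMock.c5 (40 * n + 15) ≡ (HauptMock.p10 n : ℤ) [ZMOD 2]) := by
  open HauptMock PowerSeries in
  have h53 : eu 5 ^ 3 = expand 5 (by norm_num) (eu 1 ^ 3) := by
    have := expand_eu (k := 5) (m := 1) (by norm_num) le_rfl
    simp only [Nat.reduceMul] at this
    rw [map_pow, this]
  have h1 : ∀ n : ℕ, ((c5 (8 * n + 1) : ℤ) : ZMod 2) = coeff n (eu 1 ^ 3) := fun n => by
    rw [c5_cast_odd (k := 4 * n + 1) (by push_cast; ring), (coeff_cubeQuot n).2.1]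
  have h5 : ∀ n : ℕ, ((c5 (8 * n + 5) : ℤ) : ZMod 2) = coeff n (eu 5 ^ 3) := fun n => by
    rw [c5_cast_odd (k := 4 * n + 3) (by push_cast; ring), (coeff_cubeQuot n).2.2.2]
  have h7 : ∀ (n : ℕ) (m : ℤ), m = 8 * n - 1 → ((c5 m : ℤ) : ZMod 2) = coeff n euQuot :=
    fun n m hm => by
      rw [c5_cast_odd (k := 4 * n) (by push_cast; rw [hm]; ring), (coeff_cubeQuot n).1]
  simp only [modEq_two_iff, Int.cast_zero, Int.cast_one, Int.cast_natCast]
  refine ⟨fun n hn => ?_, fun n => ⟨?_, ?_, fun i hi => ?_, fun j hj => ?_⟩, fun n => ?_,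
    fun n => ?_, fun n => ⟨?_, ?_⟩, fun n => ?_⟩
  · have e : (n : ℤ) = (n + 1 : ℕ) - 1 := by push_cast; ring
    -- The extra X only affects the constant term of j_10, which n ≥ 1 excludes.
    rw [e, c5_cast, c10_cast, map_add, coeff_X, if_neg (by omega), add_zero]
  · rw [show (2 : ℤ) * n = (2 * n + 1 : ℕ) - 1 by push_cast; ring, c5_cast, coeff_sq_odd]
  · rw [c5_cast_odd (k := 4 * n + 2) (by push_cast; ring), (coeff_cubeQuot n).2.2.1]
  · have hi' : ¬ 5 ∣ 5 * n + i := by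
      simp only [Set.mem_insert_iff, Set.mem_singleton_iff] at hi
      omega
    rw [show (40 : ℤ) * n + 5 + 8 * i = 8 * (5 * n + i : ℕ) + 5 by push_cast; ring, h5, h53,
      coeff_expand_of_not_dvd 5 _ _ hi']
  · simp only [Set.mem_insert_iff, Set.mem_singleton_iff] at hj
    rcases hj with rfl | rfl
    -- 40n+7 = 8(5n+1) - 1 and 40n+23 = 8(5n+3) - 1 fall in the two empty classes modulo 5.
    · rw [h7 (5 * n + 1) _ (by push_cast; ring), (coeff_euQuot n).2.1]
    · rw [h7 (5 * n + 3) _ (by push_cast; ring), (coeff_euQuot n).2.2.2.1]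
  · rw [h7 (5 * n) _ (by push_cast; ring), (coeff_euQuot n).1, cX10, ← coeff_red, red_mockX10]
  · rw [cChi10, ← coeff_red, red_mockChi10]
    rcases n with _ | n
    -- At n = 0 the index -9 lies below the pole, matching the factor X in the reduction of χ_10;
    -- that factor also shifts n+1 to n in the other case.
    · rw [c5_of_lt (by norm_num)]
      simp
    · rw [h7 (5 * n + 4) _ (by push_cast; ring), (coeff_euQuot n).2.2.2.2, coeff_succ_X_mul]
  · rw [h1, show (40 : ℤ) * n + 5 = 8 * (5 * n : ℕ) + 5 by push_cast; ring, h5, h53,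
      coeff_expand_mul]
  · rw [h1, ← red_thetaPsi, coeff_thetaPsi_eq_one_iff]
  · rw [h7 (5 * n + 2) _ (by push_cast; ring), (coeff_euQuot n).2.2.1, ← red_mk_p10, coeff_red,
      coeff_mk, Int.cast_natCast]
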